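/- Fix $n\ge 0$. **Rooks.** A rook matrix is an $n\times n$ matrix with entries in $\{0,1\}$ and at most one $1$ in each row and column; $R_n$ is the monoid of rook matrices under multiplication. A rook vector is $r=(r_1,\dots,r_n)\in\{0,\dots,n\}^n$ whose nonzero entries are distinct; it encodes the rook matrix whose $j$-th column is zero if $r_j=0$ and has its $1$ in row $r_j$ otherwise. Let $s_k$ ($1\le k<n$) be the matrix of the transposition $(k,k+1)$ and $P_1=\mathrm{diag}(0,1,\dots,1)$. On rook vectors (acting on the right) let $r\cdot s_k$ exchange $r_k$ and $r_{k+1}$, let $r\cdot P_1=(0,r_2,\dots,r_n)$, and let $r\cdot\pi_k=r\cdot s_k$ if $r_k<r_{k+1}$ and $r\cdot\pi_k=r$ otherwise. $F_n^1$ (resp. $F_n^0$) is the monoid of functions on rook vectors generated by $s_1,\dots,s_{n-1},P_1$ (resp. $\pi_1,\dots,\pi_{n-1},P_1$), where a product $fg$ acts by $r\cdot(fg)=(r\cdot f)\cdot g$. **Presented monoids.** $G_n^0$ is the monoid with generators $\pi_1,\dots,\pi_{n-1},P_1,\dots,P_n$ and relations (Halverson's relations for the $q$-rook algebra at $q=0$,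 with $\pi_i=T_i+1$) $$\pi_i^2=\pi_i,\quad \pi_i\pi_{i+1}\pi_i=\pi_{i+1}\pi_i\pi_{i+1},\quad \pi_i\pi_j=\pi_j\pi_i\ (|i-j|\ge2),\quad P_i^2=P_i,\quad P_iP_j=P_jP_i,$$ $$P_i\pi_j=\pi_jP_i\ (i<j),\qquad P_i\pi_j=\pi_jP_i=P_i\ (j<i),\qquad P_{i+1}=P_i\pi_iP_i\ (1\le i<n).$$ $G_n^1$ is the monoid with generators $s_1,\dots,s_{n-1},P_1$ and relations $s_i^2=1$, $s_is_{i+1}s_i=s_{i+1}s_is_{i+1}$, $s_is_j=s_js_i$ ($|i-j|\ge2$), $P_1^2=P_1$, $P_1s_j=s_jP_1$ ($j\ne1$), $s_1P_1s_1P_1=P_1s_1P_1=P_1s_1P_1s_1$. In both monoids put $\pi_0:=P_1$; in $G_n^1$ also $s_0:=P_1$. **R-codes.** For words over $\mathbb Z$ define $m(\varepsilon)=0$ and $m(wd)=-d$ if $d\le0$, $m(wd)=m(w)+1$ if $0<d\le m(w)+1$, $m(wd)=m(w)$ if $d>m(w)+1$. Let $C_n$ be the set of words $c=c_1\cdots c_n$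 over $\mathbb{Z}$ with $-m(c_1\cdots c_{k-1})\le c_k\le k$ for all $k$. For $k\ge0$ and $i\in\mathbb Z$ let $\left[{k\atop i}\right]$ be the word of indices that is empty if $i>k$, is $k,k-1,\dots,i$ if $0\le i\le k$, and is $k,\dots,1,0,1,\dots,|i|$ if $i<0$. For $c\in C_n$, concatenating $\left[{0\atop c_1}\right],\left[{1\atop c_2}\right],\dots,\left[{n-1\atop c_n}\right]$ gives a word in the indices $0,\dots,n-1$, whose length is denoted $\ell(c)$; reading the index $j$ as $\pi_j$ gives $\pi_c\in G_n^0$, reading it as $s_j$ gives $s_c\in G_n^1$. For $q\in\{0,1\}$, $c\in C_n$ and an index $0\le t\le n-1$ define $c\cdot_q t$ recursively, with $c'=c_1\cdots c_{n-1}$ and concatenation of a word and a letter written $w\,d$. If $c_n=i\ge1$: $c\cdot_q t$ is $c'(c_n+q)$ if $t=i$; $c'(c_n-1)$ if $t=i-1$; $(c'\cdot_q t)\,c_n$ if $t<i-1$; $(c'\cdot_q(t-1))\,c_n$ if $t>i$. If $c_n=-i\le0$: $c\cdot_q t$ is $(c'\cdot_q0\cdot_q1\cdots\cdot_q(i-1))\,0$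 if $t=0$; $(c'\cdot_q t)\,c_n$ if $0<t<i$; $c'(c_n+q)$ if $t=i>0$; if $t=i+1$, it is $c$ when $m(c')=i$ and $c'(-(i+1))$ otherwise; $(c'\cdot_q(t-1))\,c_n$ if $t>i+1$. **Theorem.** 1. $G_n^0$ is presented by the generators $\pi_0,\dots,\pi_{n-1}$ (with $\pi_0=P_1$) subject to (RB1) $\pi_i^2=\pi_i$ for $0\le i\le n-1$; (RB2) $\pi_i\pi_{i+1}\pi_i=\pi_{i+1}\pi_i\pi_{i+1}$ for $1\le i\le n-2$; (RB3) $\pi_1\pi_0\pi_1\pi_0=\pi_0\pi_1\pi_0=\pi_0\pi_1\pi_0\pi_1$ (if $n\ge2$); (RB4) $\pi_i\pi_j=\pi_j\pi_i$ for $|i-j|\ge2$. 2. For all $c\in C_n$ and $0\le t\le n-1$: $c\cdot_0t\in C_n$, $\pi_{c\cdot_0t}=\pi_c\,\pi_t$ in $G_n^0$, and $\ell(c\cdot_0t)\le\ell(c)+1$. Likewise $c\cdot_1t\in C_n$, $s_{c\cdot_1t}=s_c\,s_t$ in $G_n^1$, and $\ell(c\cdot_1t)\le\ell(c)+1$. 3.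 The maps $C_n\to G_n^0$, $c\mapsto\pi_c$, and $C_n\to G_n^1$, $c\mapsto s_c$, are surjective. 4. $R_n$ is finite and $|C_n|=|R_n|=|F_n^0|=|G_n^0|=|F_n^1|=|G_n^1|$. 5. There are monoid isomorphisms $G_n^0\simeq F_n^0$ and $G_n^1\simeq F_n^1$ sending each generator $\pi_0,\dots,\pi_{n-1}$, resp. $P_1,s_1,\dots,s_{n-1}$, to the operator of the same name, and a monoid isomorphism $G_n^1\simeq R_n$ sending $P_1,s_1,\dots,s_{n-1}$ to the matrices of the same name. The encoding of rook matrices by rook vectors is a bijection, and under it there is a monoid isomorphism $R_n\simeq F_n^1$ sending $A$ to right multiplication by $A$. -/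

import Mathlib

namespace ZeroRook

/-! ### The rook monoid: rook matrices and rook vectors -/

/-- A rook matrix: entries in `{0, 1}`, at most one nonzero entry in each row and in each column. -/
def IsRook {n : ℕ} (A : Matrix (Fin n) (Fin n) ℤ) : Prop :=
  (∀ i j, A i j = 0 ∨ A i j = 1) ∧
  (∀ i j j', A i j ≠ 0 → A i j' ≠ 0 → j = j') ∧
  (∀ i i' j, A i j ≠ 0 → A i' j ≠ 0 → i = i')

theorem IsRook.one (n : ℕ) : IsRook (1 : Matrix (Fin n) (Fin n) ℤ) := by
  refine ⟨fun i j => ?_, fun i j j' h h' => ?_, fun i i' j h h' => ?_⟩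
  · by_cases h : i = j <;> simp [Matrix.one_apply, h]
  · simp only [Matrix.one_apply, ne_eq, ite_eq_right_iff, one_ne_zero, imp_false,
      not_not] at h h'
    exact h.symm.trans h'
  · simp only [Matrix.one_apply, ne_eq, ite_eq_right_iff, one_ne_zero, imp_false,
      not_not] at h h'
    exact h.trans h'.symm

theorem IsRook.mul {n : ℕ} {A B : Matrix (Fin n) (Fin n) ℤ} (hA : IsRook A) (hB : IsRook B) :
    IsRook (A * B) := by
  have key : ∀ i k, (A * B) i k ≠ 0 → ∃ j, A i j ≠ 0 ∧ B j k ≠ 0 := by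
    intro i k h
    rw [Matrix.mul_apply] at h
    obtain ⟨j, -, hj⟩ := Finset.exists_ne_zero_of_sum_ne_zero h
    exact ⟨j, left_ne_zero_of_mul hj, right_ne_zero_of_mul hj⟩
  refine ⟨fun i k => ?_, fun i k k' h h' => ?_, fun i i' k h h' => ?_⟩
  · by_cases h : (A * B) i k = 0
    · exact Or.inl h
    · right
      obtain ⟨j, hj, hj'⟩ := key i k h
      rw [Matrix.mul_apply, Finset.sum_eq_single j]
      · rw [(hA.1 i j).resolve_left hj, (hB.1 j k).resolve_left hj', mul_one]
      · intro l _ hl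
        by_contra hne
        exact hl (hA.2.1 i l j (left_ne_zero_of_mul hne) hj)
      · intro hn
        exact absurd (Finset.mem_univ j) hn
  · obtain ⟨j, hj, hk⟩ := key i k h
    obtain ⟨j', hj', hk'⟩ := key i k' h'
    obtain rfl := hA.2.1 i j j' hj hj'
    exact hB.2.1 j k k' hk hk'
  · obtain ⟨j, hj, hk⟩ := key i k h
    obtain ⟨j', hj', hk'⟩ := key i' k h'
    obtain rfl := hB.2.2 j j' k hk hk'
    exact hA.2.2 i i' j hj hj'

/-- The rook monoid `R_n`: the monoid of rook matrices of size `n` under matrix multiplication. -/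
def RookMonoid (n : ℕ) : Submonoid (Matrix (Fin n) (Fin n) ℤ) where
  carrier := {A | IsRook A}
  one_mem' := IsRook.one n
  mul_mem' hA hB := hA.mul hB

/-- Rook vectors `(r_1, …, r_n)`: entries in `{0, …, n}`, where only `0` may be repeated.
The entry `r_k` is the value at the index `k - 1 : Fin n`. -/
def RookVec (n : ℕ) : Type :=
  {r : Fin n → Fin (n + 1) // ∀ i j, r i = r j → r i ≠ 0 → i = j}

/-- The rook matrix encoded by the rook vector `r`: if `r_j = 0` then the `j`-th column is zero,
otherwise the `1` of the `j`-th column is in row number `r_j` (rows being numbered from `1`). -/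
def rookMatrix {n : ℕ} (r : RookVec n) : RookMonoid n :=
  ⟨Matrix.of fun i j => if (r.1 j : ℕ) = (i : ℕ) + 1 then 1 else 0, by
    refine ⟨fun i j => ?_, fun i j j' h h' => ?_, fun i i' j h h' => ?_⟩
    · by_cases h : (r.1 j : ℕ) = (i : ℕ) + 1 <;> simp [h]
    · simp only [Matrix.of_apply, ne_eq, ite_eq_right_iff, one_ne_zero, imp_false, not_not]
        at h h'
      refine r.2 j j' (Fin.ext (h.trans h'.symm)) (fun h0 => ?_)
      rw [h0] at h
      simp at h
    · simp only [Matrix.of_apply, ne_eq, ite_eq_right_iff, one_ne_zero, imp_false, not_not]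
        at h h'
      exact Fin.ext (by omega)⟩

/-- The index preceding `i` (only used for `i ≠ 0`). -/
def prev {n : ℕ} (i : Fin n) : Fin n := ⟨(i : ℕ) - 1, by omega⟩

/-- The generators of the rook monoid, as matrices: the index `0` stands for the diagonal matrix
`P_1 = diag(0, 1, …, 1)`, and the index `k ≥ 1` for the matrix `s_k` of the elementary
transposition `(k, k + 1)`. -/
def rookGen {n : ℕ} (i : Fin n) : Matrix (Fin n) (Fin n) ℤ :=
  if (i : ℕ) = 0 then Matrix.diagonal fun j => if (j : ℕ) = 0 then 0 else 1
  else (Equiv.swap (prev i) i).permMatrix ℤ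

/-! ### The monoids of operators on rook vectors -/

/-- `(r_1, r_2, …, r_n) ↦ (0, r_2, …, r_n)`. -/
def killFirst {n : ℕ} (r : RookVec n) : RookVec n :=
  ⟨fun j => if (j : ℕ) = 0 then 0 else r.1 j, by
    intro i j h h0
    by_cases hi : (i : ℕ) = 0
    · simp [hi] at h0
    · by_cases hj : (j : ℕ) = 0
      · simp only [hi, hj, if_true, if_false] at h h0
        exact absurd h h0
      · simp only [hi, hj, if_false] at h h0
        exact r.2 i j h h0⟩

/-- Exchange the entries `r_k` and `r_{k+1}`, where `k ≥ 1` is the value of `i`. -/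
def swapAt {n : ℕ} (i : Fin n) (r : RookVec n) : RookVec n :=
  ⟨fun j => r.1 (Equiv.swap (prev i) i j), fun _ _ h h0 =>
    (Equiv.swap (prev i) i).injective (r.2 _ _ h h0)⟩

/-- The operators generating `F_n^1`: the index `0` stands for `P_1`, the index `k ≥ 1` for
`s_k`. -/
def op1 {n : ℕ} (i : Fin n) (r : RookVec n) : RookVec n :=
  if (i : ℕ) = 0 then killFirst r else swapAt i r

/-- The operators generating `F_n^0`: the index `0` stands for `P_1 = π_0`, the index `k ≥ 1` for
`π_k`, which exchanges `r_k` and `r_{k+1}` if `r_k < r_{k+1}` and does nothing otherwise. -/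
def op0 {n : ℕ} (i : Fin n) (r : RookVec n) : RookVec n :=
  if (i : ℕ) = 0 then killFirst r
  else if r.1 (prev i) < r.1 i then swapAt i r else r

/-- The monoid of all functions `R_n → R_n` acting on the right, that is with the product
`r · (f g) = (r · f) · g`. -/
abbrev RightFun (n : ℕ) : Type := (Function.End (RookVec n))ᵐᵒᵖ

/-- A function on rook vectors as an element of `RightFun n`. -/
def rightFun {n : ℕ} (f : RookVec n → RookVec n) : RightFun n :=
  MulOpposite.op (f : Function.End (RookVec n))

/-- The result `r · f` of applying the operator `f` to the rook vector `r`. -/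
def applyTo {n : ℕ} (r : RookVec n) (f : RightFun n) : RookVec n :=
  (MulOpposite.unop f : RookVec n → RookVec n) r

/-- The monoid `F_n^0` of functions on rooks generated by `P_1, π_1, …, π_{n-1}`. -/
def F0 (n : ℕ) : Submonoid (RightFun n) :=
  Submonoid.closure (Set.range fun i : Fin n => rightFun (op0 i))

/-- The monoid `F_n^1` of functions on rooks generated by `P_1, s_1, …, s_{n-1}`. -/
def F1 (n : ℕ) : Submonoid (RightFun n) :=
  Submonoid.closure (Set.range fun i : Fin n => rightFun (op1 i))

/-! ### The presented monoids -/

/-- The generators `π_1, …, π_{n-1}` and `P_1, …, P_n` of `G_n^0`. -/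
inductive HGen (n : ℕ) : Type
  | pi (i : ℕ) (h : 1 ≤ i ∧ i < n) : HGen n
  | P (i : ℕ) (h : 1 ≤ i ∧ i ≤ n) : HGen n

/-- The generator `π_i` as a one-letter word. -/
def wpi {n : ℕ} (i : ℕ) (h : 1 ≤ i ∧ i < n) : FreeMonoid (HGen n) := FreeMonoid.of (HGen.pi i h)

/-- The generator `P_i` as a one-letter word. -/
def wP {n : ℕ} (i : ℕ) (h : 1 ≤ i ∧ i ≤ n) : FreeMonoid (HGen n) := FreeMonoid.of (HGen.P i h)

/-- Halverson's relations at `q = 0`, written with `π_i = T_i + 1`. -/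
inductive HRel (n : ℕ) : FreeMonoid (HGen n) → FreeMonoid (HGen n) → Prop
  | r1 (i : ℕ) (hi : 1 ≤ i ∧ i < n) : HRel n (wpi i hi * wpi i hi) (wpi i hi)
  | r2 (i : ℕ) (hi : 1 ≤ i ∧ i < n) (hj : 1 ≤ i + 1 ∧ i + 1 < n) :
      HRel n (wpi i hi * wpi (i + 1) hj * wpi i hi) (wpi (i + 1) hj * wpi i hi * wpi (i + 1) hj)
  | r3 (i j : ℕ) (hi : 1 ≤ i ∧ i < n) (hj : 1 ≤ j ∧ j < n) (hij : i + 2 ≤ j ∨ j + 2 ≤ i) :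
      HRel n (wpi i hi * wpi j hj) (wpi j hj * wpi i hi)
  | r4 (i : ℕ) (hi : 1 ≤ i ∧ i ≤ n) : HRel n (wP i hi * wP i hi) (wP i hi)
  | r5 (i j : ℕ) (hi : 1 ≤ i ∧ i ≤ n) (hj : 1 ≤ j ∧ j ≤ n) :
      HRel n (wP i hi * wP j hj) (wP j hj * wP i hi)
  | r6 (i j : ℕ) (hi : 1 ≤ i ∧ i ≤ n) (hj : 1 ≤ j ∧ j < n) (hij : i < j) :
      HRel n (wP i hi * wpi j hj) (wpi j hj * wP i hi)
  | r7_right (i j : ℕ) (hi : 1 ≤ i ∧ i ≤ n) (hj : 1 ≤ j ∧ j < n) (hij : j < i) :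
      HRel n (wP i hi * wpi j hj) (wP i hi)
  | r7_left (i j : ℕ) (hi : 1 ≤ i ∧ i ≤ n) (hj : 1 ≤ j ∧ j < n) (hij : j < i) :
      HRel n (wpi j hj * wP i hi) (wP i hi)
  | r8 (i : ℕ) (hp : 1 ≤ i ∧ i < n) (hi : 1 ≤ i ∧ i ≤ n) (hj : 1 ≤ i + 1 ∧ i + 1 ≤ n) :
      HRel n (wP (i + 1) hj) (wP i hi * wpi i hp * wP i hi)

/-- The monoid `G_n^0`. -/
abbrev G0 (n : ℕ) : Type := PresentedMonoid (HRel n)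

/-- The elements `π_0 = P_1` and `π_1, …, π_{n-1}` of `G_n^0` (with the value `1` at the indices
`i ≥ n`, which are not used). -/
def pi0 (n i : ℕ) : G0 n :=
  if h : i < n then
    if h0 : i = 0 then PresentedMonoid.of (HRel n) (HGen.P 1 ⟨le_refl 1, by omega⟩)
    else PresentedMonoid.of (HRel n) (HGen.pi i ⟨by omega, h⟩)
  else 1

open FreeMonoid in
/-- The relations RB1 – RB4 between the letters `π_0, …, π_{n-1}`. -/
inductive RBRel (n : ℕ) : FreeMonoid (Fin n) → FreeMonoid (Fin n) → Prop
  | rb1 (i : Fin n) : RBRel n (of i * of i) (of i)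
  | rb2 (i j : Fin n) (hi : 1 ≤ (i : ℕ)) (hj : (j : ℕ) = i + 1) :
      RBRel n (of i * of j * of i) (of j * of i * of j)
  | rb3_left (i j : Fin n) (hi : (i : ℕ) = 0) (hj : (j : ℕ) = 1) :
      RBRel n (of j * of i * of j * of i) (of i * of j * of i)
  | rb3_right (i j : Fin n) (hi : (i : ℕ) = 0) (hj : (j : ℕ) = 1) :
      RBRel n (of i * of j * of i) (of i * of j * of i * of j)
  | rb4 (i j : Fin n) (hij : (i : ℕ) + 2 ≤ j ∨ (j : ℕ) + 2 ≤ i) :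
      RBRel n (of i * of j) (of j * of i)

open FreeMonoid in
/-- The relations of `G_n^1`; the letter `0` stands for `P_1` and the letter `k ≥ 1` for `s_k`. -/
inductive RsRel (n : ℕ) : FreeMonoid (Fin n) → FreeMonoid (Fin n) → Prop
  | rs1 (i : Fin n) (hi : 1 ≤ (i : ℕ)) : RsRel n (of i * of i) 1
  | rs2 (i j : Fin n) (hi : 1 ≤ (i : ℕ)) (hj : (j : ℕ) = i + 1) :
      RsRel n (of i * of j * of i) (of j * of i * of j)
  | rs3 (i j : Fin n) (hi : 1 ≤ (i : ℕ)) (hj : 1 ≤ (j : ℕ))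
      (hij : (i : ℕ) + 2 ≤ j ∨ (j : ℕ) + 2 ≤ i) :
      RsRel n (of i * of j) (of j * of i)
  | rs4 (p : Fin n) (hp : (p : ℕ) = 0) : RsRel n (of p * of p) (of p)
  | rs5 (p j : Fin n) (hp : (p : ℕ) = 0) (hj : 1 ≤ (j : ℕ)) (hj1 : (j : ℕ) ≠ 1) :
      RsRel n (of p * of j) (of j * of p)
  | rs6_left (p j : Fin n) (hp : (p : ℕ) = 0) (hj : (j : ℕ) = 1) :
      RsRel n (of j * of p * of j * of p) (of p * of j * of p)
  | rs6_right (p j : Fin n) (hp : (p : ℕ) = 0) (hj : (j : ℕ) = 1) :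
      RsRel n (of p * of j * of p) (of p * of j * of p * of j)

/-- The monoid `G_n^1`. -/
abbrev G1 (n : ℕ) : Type := PresentedMonoid (RsRel n)

/-- The generators `P_1` (index `0`) and `s_1, …, s_{n-1}` of `G_n^1` (with the value `1` at the
indices `i ≥ n`, which are not used). -/
def s1 (n i : ℕ) : G1 n :=
  if h : i < n then PresentedMonoid.of (RsRel n) ⟨i, h⟩ else 1

/-! ### R-codes, canonical words, and the action of the generators on R-codes -/

/-- The word obtained from `c` by appending the letter `d`. -/
def snocWord {n : ℕ} (c : Fin n → ℤ) (d : ℤ) : Fin (n + 1) → ℤ :=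
  Fin.snoc (α := fun _ => ℤ) c d

/-- The statistic `m(c)` of a word `c = c_1 … c_n` over `ℤ`. -/
def codeM : (n : ℕ) → (Fin n → ℤ) → ℤ
  | 0, _ => 0
  | n + 1, c =>
    let d := c (Fin.last n)
    let m := codeM n (Fin.init c)
    if d ≤ 0 then -d else if d ≤ m + 1 then m + 1 else m

/-- `c = c_1 … c_n` is an R-code: `-m(c_1 … c_{k-1}) ≤ c_k ≤ k` for all `k`. -/
def IsRCode : (n : ℕ) → (Fin n → ℤ) → Prop
  | 0, _ => True
  | n + 1, c =>
    IsRCode n (Fin.init c) ∧ -codeM n (Fin.init c) ≤ c (Fin.last n) ∧ c (Fin.last n) ≤ n + 1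

/-- The set `C_n` of R-codes of size `n`. -/
def RCodes (n : ℕ) : Set (Fin n → ℤ) := {c | IsRCode n c}

/-- The indices of the letters of the column word with top index `n` and bottom index `i`:
empty if `i > n`, equal to `n, n-1, …, i` if `0 ≤ i ≤ n`, and to `n, …, 1, 0, 1, …, |i|` if
`i < 0`. -/
def colWord (n : ℕ) (i : ℤ) : List ℕ :=
  if (n : ℤ) < i then []
  else if 0 ≤ i then (List.range' i.toNat (n + 1 - i.toNat)).reverse
  else (List.range (n + 1)).reverse ++ List.range' 1 i.natAbs

/-- The canonical word attached to `c = c_1 … c_n`: the concatenation of the columns with top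
index `k - 1` and bottom index `c_k`, for `k = 1, …, n`. It is given by the indices of its letters,
the letter with index `0` being `π_0 = P_1`. -/
def codeWord : (n : ℕ) → (Fin n → ℤ) → List ℕ
  | 0, _ => []
  | n + 1, c => codeWord n (Fin.init c) ++ colWord n (c (Fin.last n))

/-- The element `π_c` of `G_n^0`. -/
def piCode (n : ℕ) (c : Fin n → ℤ) : G0 n := ((codeWord n c).map (pi0 n)).prod

/-- The element `s_c` of `G_n^1`. -/
def sCode (n : ℕ) (c : Fin n → ℤ) : G1 n := ((codeWord n c).map (s1 n)).prod

/-- The action `c · t` of the generator with index `t` on the R-code `c`. For `q = 0` this is the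
action of `π_0, …, π_{n-1}`, for `q = 1` the action of `π_0 = P_1, s_1, …, s_{n-1}`; the two
recursions differ only in the case `t ≠ 0`, `t = |c_n|`, where the last letter becomes
`c_n + q`. -/
def codeAct (q : ℤ) : (n : ℕ) → (Fin n → ℤ) → ℕ → (Fin n → ℤ)
  | 0, c, _ => c
  | n + 1, c, t =>
    let c' : Fin n → ℤ := Fin.init c
    let d : ℤ := c (Fin.last n)
    if 1 ≤ d then
      if (t : ℤ) = d then snocWord c' (d + q)
      else if (t : ℤ) = d - 1 then snocWord c' (d - 1)
      else if (t : ℤ) < d - 1 then snocWord (codeAct q n c' t) d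
      else snocWord (codeAct q n c' (t - 1)) d
    else
      let i : ℕ := (-d).toNat
      if t = 0 then snocWord ((List.range i).foldl (codeAct q n) c') 0
      else if t < i then snocWord (codeAct q n c' t) d
      else if t = i then snocWord c' (d + q)
      else if t = i + 1 then
        if codeM n c' = i then c else snocWord c' (-((i : ℤ) + 1))
      else snocWord (codeAct q n c' (t - 1)) d

end ZeroRook

open ZeroRook

/-!
Everything rests on one comparison. The generators of `G_n^0` and of `G_n^1` satisfy a common set
of relations (`RookRelations`), and these, together with `π_t² = π_t` or `s_t² = 1`, suffice to
multiply a canonical word by a generator on the right: the result is the canonical word of the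
R-code `c · t` (`RookRelations.codeAct_spec`). A letter either modifies the last column or passes
through it, possibly lowered by one, and acts on the shorter code; the letter `0` may turn into
several letters `0, 1, …, i - 1` acting on the shorter code (`RookRelations.col_mul_zero`). Only one
case looks at several columns at once, the insertion of a zero just before the first earlier zero
(`RookRelations.codeProd_absorb`). Hence every element of a presented monoid is the value of the
canonical word of an R-code, which bounds the size of the monoid from above.

For the lower bound the presented monoids act on rook vectors. The canonical word of `c` sends
`(1, 2, …, n)` to a rook vector that is built by inserting, column after column, either the next
letter or a zero; here `m(c)` is the number of entries before the first zero
(`codeVec_eq_zero`). No exchange in this process depends on the difference between `s_k` and `π_k`,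
and every rook vector has exactly one R-code (`codeVec_injOn`, `exists_codeVec_eq`). So R-codes,
rook vectors and elements of either presented monoid correspond bijectively, and the presented
monoids act faithfully (`ActsLikeRook.injective_of_surjective_code`), which identifies them with
`F_n^0` and `F_n^1`. Right multiplication by rook matrices is faithful on rook vectors as well and
the generators act in the same way, so `R_n` is identified with `F_n^1`.

The presentation of `G_n^0` by `π_0, …, π_{n-1}` is obtained by recovering the other generators as
`P_{i+1} = P_i π_i P_i` and deriving from the relations RB1 – RB4 that `P_i` is idempotent and
absorbs `π_0, …, π_{i-1}` on both sides (`RookRelations.killer_idem_and_mul_gen`).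
-/

namespace ZeroRook

/-! ### Words in a monoid with elements satisfying the braid-like relations -/

section Words

variable {M : Type*} [Monoid M]

/-- The relations shared by the generators of `G_n^0` and of `G_n^1`: all of RB1 – RB4 for the
elements `g 0, …, g (N - 1)`, except that nothing is said about the squares of `g 1, …, g (N - 1)`.
Values of `g` at indices `≥ N` are unconstrained. -/
structure RookRelations (N : ℕ) (g : ℕ → M) : Prop where
  zero_mul_zero : 0 < N → g 0 * g 0 = g 0
  braid : ∀ i, 1 ≤ i → i + 1 < N → g i * g (i + 1) * g i = g (i + 1) * g i * g (i + 1)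
  comm : ∀ i j, j < N → i + 2 ≤ j → g i * g j = g j * g i
  one_zero : 1 < N → g 1 * g 0 * g 1 * g 0 = g 0 * g 1 * g 0
  zero_one : 1 < N → g 0 * g 1 * g 0 * g 1 = g 0 * g 1 * g 0

/-- The value of a word of indices. -/
def wordProd (g : ℕ → M) (w : List ℕ) : M := (w.map g).prod

/-- The product `g a * g (a + 1) * ⋯ * g (a + l - 1)` of `l` factors. -/
def up (g : ℕ → M) (a l : ℕ) : M := wordProd g (List.range' a l)

/-- The product `g (a + l - 1) * ⋯ * g (a + 1) * g a` of `l` factors. -/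
def down (g : ℕ → M) (a l : ℕ) : M := wordProd g (List.range' a l).reverse

variable {g : ℕ → M} {N : ℕ}

theorem wordProd_append (v w : List ℕ) : wordProd g (v ++ w) = wordProd g v * wordProd g w := by
  simp [wordProd]

theorem up_zero (a : ℕ) : up g a 0 = 1 := by simp [up, wordProd]

theorem down_zero (a : ℕ) : down g a 0 = 1 := by simp [down, wordProd]

theorem up_add (a k l : ℕ) : up g a (k + l) = up g a k * up g (a + k) l := by
  rw [up, up, up, ← wordProd_append, List.range'_append_1]

theorem down_add (a k l : ℕ) : down g a (k + l) = down g (a + k) l * down g a k := by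
  rw [down, down, down, ← wordProd_append, ← List.reverse_append, List.range'_append_1]

theorem up_one (a : ℕ) : up g a 1 = g a := by simp [up, wordProd]

theorem down_one (a : ℕ) : down g a 1 = g a := by simp [down, wordProd]

theorem up_succ (a l : ℕ) : up g a (l + 1) = up g a l * g (a + l) := by rw [up_add, up_one]

theorem up_succ' (a l : ℕ) : up g a (l + 1) = g a * up g (a + 1) l := by
  rw [add_comm, up_add, up_one]

theorem down_succ (a l : ℕ) : down g a (l + 1) = g (a + l) * down g a l := by
  rw [down_add, down_one]

theorem down_succ' (a l : ℕ) : down g a (l + 1) = down g (a + 1) l * g a := by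
  rw [add_comm, down_add, down_one]

theorem wordProd_colWord_pos {n d : ℕ} (hd : d ≤ n + 1) :
    wordProd g (colWord n d) = down g d (n + 1 - d) := by
  unfold colWord
  split_ifs with h
  · have : n + 1 - d = 0 := by omega
    rw [this, down_zero]; simp [wordProd]
  · simp [down]
  · omega

theorem wordProd_colWord_neg (n i : ℕ) :
    wordProd g (colWord n (-(i : ℤ))) = down g 0 (n + 1) * up g 1 i := by
  unfold colWord
  rw [if_neg (by omega)]
  split_ifs with h
  · have : i = 0 := by omega
    subst this
    simp [down, up_zero]
  · rw [wordProd_append, down, up, List.range_eq_range', Int.natAbs_neg, Int.natAbs_natCast]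

namespace RookRelations

/-! ### Moving letters through runs -/

variable (h : RookRelations N g)
include h

theorem commute_far {i j : ℕ} (hi : i < N) (hj : j < N) (hij : i + 2 ≤ j ∨ j + 2 ≤ i) :
    Commute (g i) (g j) := by
  rcases hij with hij | hij
  · exact h.comm i j hj hij
  · exact (h.comm j i hi hij).symm

theorem commute_wordProd {w : List ℕ} {t : ℕ} (ht : t < N)
    (hw : ∀ j ∈ w, j < N ∧ (j + 2 ≤ t ∨ t + 2 ≤ j)) : Commute (wordProd g w) (g t) := by
  apply Commute.symm
  apply Commute.list_prod_right
  intro x hx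
  obtain ⟨j, hj, rfl⟩ := List.mem_map.1 hx
  exact h.commute_far ht (hw j hj).1 (by have := (hw j hj).2; omega)

theorem commute_down {a l t : ℕ} (ht : t < N) (hl : l = 0 ∨ a + l ≤ N)
    (hw : a + l + 1 ≤ t ∨ t + 2 ≤ a) : Commute (down g a l) (g t) := by
  refine h.commute_wordProd ht fun j hj => ?_
  simp only [List.mem_reverse, List.mem_range'_1] at hj
  omega

theorem commute_up {a l t : ℕ} (ht : t < N) (hl : l = 0 ∨ a + l ≤ N)
    (hw : a + l + 1 ≤ t ∨ t + 2 ≤ a) : Commute (up g a l) (g t) := by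
  refine h.commute_wordProd ht fun j hj => ?_
  simp only [List.mem_range'_1] at hj
  omega

/-- A letter passes a descending run from right to left and is lowered by one. -/
theorem down_mul_gen {a l t : ℕ} (ha : a < t) (ht : t < a + l) (hl : a + l ≤ N) (h1 : 2 ≤ t) :
    down g a l * g t = g (t - 1) * down g a l := by
  obtain ⟨p, rfl⟩ : ∃ p, t = a + p + 1 := ⟨t - a - 1, by omega⟩
  obtain ⟨r, rfl⟩ : ∃ r, l = p + 1 + 1 + r := ⟨l - p - 2, by omega⟩
  have e1 : down g a p * g (a + p + 1) = g (a + p + 1) * down g a p :=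
    h.commute_down (by omega) (by omega) (by omega)
  have e2 : down g (a + p + 2) r * g (a + p) = g (a + p) * down g (a + p + 2) r :=
    h.commute_down (by omega) (by omega) (by omega)
  have e3 := h.braid (a + p) (by omega) (by omega)
  simp only [down_add (l := r), down_succ, ← add_assoc] at e2 ⊢
  calc _ = down g (a + p + 2) r * (g (a + p + 1) * g (a + p) * (down g a p * g (a + p + 1))) := by
        simp only [mul_assoc]
    _ = down g (a + p + 2) r * (g (a + p + 1) * g (a + p) * g (a + p + 1)) * down g a p := by
        rw [e1]; simp only [mul_assoc]
    _ = (down g (a + p + 2) r * g (a + p)) * g (a + p + 1) * g (a + p) * down g a p := by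
        rw [← e3]; simp only [mul_assoc]
    _ = _ := by
        rw [e2]; simp only [mul_assoc, add_tsub_cancel_right]

/-- A letter passes an ascending run from right to left and is raised by one. -/
theorem up_mul_gen {a l t : ℕ} (ha : a ≤ t) (ht : t + 1 < a + l) (hl : a + l ≤ N) (h1 : 1 ≤ t) :
    up g a l * g t = g (t + 1) * up g a l := by
  obtain ⟨p, rfl⟩ : ∃ p, t = a + p := ⟨t - a, by omega⟩
  obtain ⟨r, rfl⟩ : ∃ r, l = p + 1 + 1 + r := ⟨l - p - 2, by omega⟩
  have e1 : up g a p * g (a + p + 1) = g (a + p + 1) * up g a p :=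
    h.commute_up (by omega) (by omega) (by omega)
  have e2 : up g (a + p + 2) r * g (a + p) = g (a + p) * up g (a + p + 2) r :=
    h.commute_up (by omega) (by omega) (by omega)
  have e3 := h.braid (a + p) (by omega) (by omega)
  simp only [up_add (l := r), up_succ, ← add_assoc] at e2 ⊢
  calc _ = up g a p * g (a + p) * g (a + p + 1) * (up g (a + p + 2) r * g (a + p)) := by
        simp only [mul_assoc]
    _ = up g a p * (g (a + p) * g (a + p + 1) * g (a + p)) * up g (a + p + 2) r := by
        rw [e2]; simp only [mul_assoc]
    _ = (up g a p * g (a + p + 1)) * g (a + p) * g (a + p + 1) * up g (a + p + 2) r := by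
        rw [e3]; simp only [mul_assoc]
    _ = _ := by
        rw [e1]; simp only [mul_assoc]

/-- A whole word passes a descending run from left to right, every letter being raised by one. -/
theorem wordProd_mul_down {b l : ℕ} (hl : b + l ≤ N) (w : List ℕ)
    (hw : ∀ j ∈ w, 1 ≤ j ∧ b ≤ j ∧ j + 1 < b + l) :
    wordProd g w * down g b l = down g b l * wordProd g (w.map (1 + ·)) := by
  induction w with
  | nil => simp [wordProd]
  | cons t w ih =>
    have ih := ih fun j hj => hw j (List.mem_cons_of_mem _ hj)
    have ht := hw t List.mem_cons_self
    have e := h.down_mul_gen (a := b) (l := l) (t := 1 + t) (by omega) (by omega) hl (by omega)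
    rw [Nat.add_sub_cancel_left] at e
    simp only [wordProd, List.map_cons, List.prod_cons] at ih ⊢
    rw [mul_assoc, ih, ← mul_assoc, ← e, mul_assoc]

theorem up_mul_down {a p b l : ℕ} (hl : b + l ≤ N) (ha : 1 ≤ a) (hb : b ≤ a)
    (hp : p = 0 ∨ a + p < b + l) :
    up g a p * down g b l = down g b l * up g (a + 1) p := by
  rw [up, h.wordProd_mul_down hl, List.map_add_range', ← up, add_comm 1 a]
  intro j hj
  simp only [List.mem_range'_1] at hj
  omega

theorem down_mul_down {a p b l : ℕ} (hl : b + l ≤ N) (ha : 1 ≤ a) (hb : b ≤ a)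
    (hp : p = 0 ∨ a + p < b + l) :
    down g a p * down g b l = down g b l * down g (a + 1) p := by
  rw [down, h.wordProd_mul_down hl, List.map_reverse, List.map_add_range', ← down, add_comm 1 a]
  intro j hj
  simp only [List.mem_reverse, List.mem_range'_1] at hj
  omega

/-- `(2 ⋯ i+1)(1 ⋯ i+1) = 1 (2 ⋯ i+1)(1 ⋯ i)`. -/
theorem up_two_mul_up_one {i : ℕ} (hN : i + 1 < N) :
    up g 2 i * up g 1 (i + 1) = g 1 * (up g 2 i * up g 1 i) := by
  have key : ∀ p, p ≤ i → up g 1 (i + 1) * up g 1 p = up g 2 p * up g 1 (i + 1) := by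
    intro p hp
    induction p with
    | zero => simp [up_zero]
    | succ p ih =>
      rw [up_succ (l := p), up_succ (l := p), ← mul_assoc, ih (by omega), mul_assoc, mul_assoc,
        h.up_mul_gen (by omega) (by omega) (by omega) (by omega)]
      congr 3; omega
  rw [← key i le_rfl, up_succ', mul_assoc]

theorem commute_down_up {a p b l : ℕ} (hb : b + l + 1 ≤ a) (ha : p = 0 ∨ a + p ≤ N) :
    Commute (down g a p) (up g b l) := by
  apply Commute.list_prod_right
  intro x hx
  obtain ⟨j, hj, rfl⟩ := List.mem_map.1 hx
  simp only [List.mem_range'_1] at hj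
  rcases Nat.eq_zero_or_pos p with rfl | hp
  · rw [down_zero]; exact Commute.one_left _
  · exact h.commute_down (by omega) (by omega) (by omega)

/-- Two successive runs that insert a zero at the first position absorb the exchange of the two
zeros. -/
theorem two_zeros {k : ℕ} (hk : 1 ≤ k) (hN : k < N) :
    down g 0 k * down g 1 k * g 0 * g 1 = down g 0 k * down g 1 k * g 0 := by
  obtain ⟨k, rfl⟩ : ∃ k', k = k' + 1 := ⟨k - 1, by omega⟩
  have e : down g 2 k * g 0 = g 0 * down g 2 k := h.commute_down (by omega) (by omega) (by omega)
  rw [down_succ' (a := 0), down_succ' (a := 1)]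
  calc _ = down g 1 k * (g 0 * down g 2 k) * g 1 * g 0 * g 1 := by simp only [mul_assoc, zero_add]
    _ = down g 1 k * down g 2 k * (g 0 * g 1 * g 0 * g 1) := by rw [← e]; simp only [mul_assoc]
    _ = down g 1 k * (down g 2 k * g 0) * g 1 * g 0 := by
      rw [h.zero_one (by omega)]; simp only [mul_assoc]
    _ = _ := by rw [e]; simp only [mul_assoc, zero_add]

/-- Inserting a letter at position `d` and then a zero to the right of it amounts, up to a factor
`g k` on the left, to inserting the zero first. -/
theorem down_mul_col_le {k d i : ℕ} (hd : 1 ≤ d) (hdi : d ≤ i) (hi : i ≤ k) (hk : k < N) :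
    down g d (k - d) * (down g 0 (k + 1) * up g 1 i) =
      g k * (down g 0 k * up g 1 (i - 1)) * down g d (k + 1 - d) := by
  have e1 : down g d (k - d) * down g 0 (k + 1) = down g 0 (k + 1) * down g (d + 1) (k - d) :=
    h.down_mul_down (by omega) (by omega) (by omega) (by omega)
  have e2 : up g 1 i = up g 1 (d - 1) * (g d * up g (d + 1) (i - d)) := by
    rw [← up_succ', show i = (d - 1) + (i - d + 1) by omega, up_add]
    congr 2 <;> omega
  have e3 : down g (d + 1) (k - d) * up g 1 (d - 1) = up g 1 (d - 1) * down g (d + 1) (k - d) :=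
    h.commute_down_up (by omega) (by omega)
  have e4 : down g (d + 1) (k - d) * g d = down g d (k + 1 - d) := by
    rw [← down_succ']; congr 1; omega
  have e5 : up g d (i - d) * down g d (k + 1 - d) = down g d (k + 1 - d) * up g (d + 1) (i - d) :=
    h.up_mul_down (by omega) (by omega) (by omega) (by omega)
  have e6 : up g 1 (i - 1) = up g 1 (d - 1) * up g d (i - d) := by
    rw [show i - 1 = (d - 1) + (i - d) by omega, up_add]
    congr 2; omega
  rw [← mul_assoc, e1, e2, down_succ, zero_add]
  calc _ = g k * down g 0 k * (down g (d + 1) (k - d) * up g 1 (d - 1)) * g d *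
        up g (d + 1) (i - d) := by simp only [mul_assoc]
    _ = g k * down g 0 k * up g 1 (d - 1) * ((down g (d + 1) (k - d) * g d) *
        up g (d + 1) (i - d)) := by rw [e3]; simp only [mul_assoc]
    _ = _ := by rw [e4, ← e5, e6]; simp only [mul_assoc]

/-- Inserting a letter at position `d` and then a zero to the left of it amounts, up to a factor
`g k` on the left, to inserting the zero first. -/
theorem down_mul_col_lt {k d i : ℕ} (hd : i < d) (hk : k < N) :
    down g d (k - d) * (down g 0 (k + 1) * up g 1 i) =
      g k * (down g 0 k * up g 1 i) * down g (d + 1) (k - d) := by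
  have e1 : down g d (k - d) * down g 0 (k + 1) = down g 0 (k + 1) * down g (d + 1) (k - d) :=
    h.down_mul_down (by omega) (by omega) (by omega) (by omega)
  have e3 : down g (d + 1) (k - d) * up g 1 i = up g 1 i * down g (d + 1) (k - d) :=
    h.commute_down_up (by omega) (by omega)
  rw [← mul_assoc, e1, mul_assoc, e3, down_succ, zero_add]
  simp only [mul_assoc]

/-- Inserting two zeros at the same position absorbs the exchange of these zeros. -/
theorem col_mul_col {k i : ℕ} (hi : i < k) (hk : k < N) :
    down g 0 k * up g 1 i * (down g 0 (k + 1) * up g 1 (i + 1)) =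
      down g 0 k * up g 1 i * (down g 0 (k + 1) * up g 1 i) := by
  have e1 : up g 1 i * down g 0 (k + 1) = down g 0 (k + 1) * up g 2 i :=
    h.up_mul_down (by omega) le_rfl (by omega) (by omega)
  have e2 := h.two_zeros (k := k) (by omega) hk
  have e3 : down g 0 (k + 1) = down g 1 k * g 0 := down_succ' 0 k
  calc _ = down g 0 k * (up g 1 i * down g 0 (k + 1)) * up g 1 (i + 1) := by
        simp only [mul_assoc]
    _ = down g 0 k * down g 1 k * g 0 * (up g 2 i * up g 1 (i + 1)) := by
        rw [e1, e3]; simp only [mul_assoc]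
    _ = (down g 0 k * down g 1 k * g 0 * g 1) * (up g 2 i * up g 1 i) := by
        rw [h.up_two_mul_up_one (by omega)]; simp only [mul_assoc]
    _ = down g 0 k * (down g 1 k * g 0 * up g 2 i) * up g 1 i := by
        rw [e2]; simp only [mul_assoc]
    _ = _ := by rw [← e3, ← e1]; simp only [mul_assoc]

end RookRelations

/-! ### R-codes and canonical words -/

/-- The value of the canonical word of `c`. -/
def codeProd (g : ℕ → M) (n : ℕ) (c : Fin n → ℤ) : M := wordProd g (codeWord n c)

theorem codeProd_succ (n : ℕ) (c : Fin (n + 1) → ℤ) :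
    codeProd g (n + 1) c = codeProd g n (Fin.init c) * wordProd g (colWord n (c (Fin.last n))) :=
  wordProd_append _ _

theorem codeM_succ (n : ℕ) (c : Fin (n + 1) → ℤ) :
    codeM (n + 1) c = if c (Fin.last n) ≤ 0 then -c (Fin.last n)
      else if c (Fin.last n) ≤ codeM n (Fin.init c) + 1 then codeM n (Fin.init c) + 1
      else codeM n (Fin.init c) := rfl

theorem mem_RCodes_succ {n : ℕ} {c : Fin (n + 1) → ℤ} :
    c ∈ RCodes (n + 1) ↔ Fin.init c ∈ RCodes n ∧ -codeM n (Fin.init c) ≤ c (Fin.last n) ∧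
      c (Fin.last n) ≤ n + 1 := Iff.rfl

@[simp] theorem init_snocWord {n : ℕ} (c : Fin n → ℤ) (d : ℤ) : Fin.init (snocWord c d) = c := by
  simp [snocWord]

@[simp] theorem snocWord_last {n : ℕ} (c : Fin n → ℤ) (d : ℤ) :
    snocWord c d (Fin.last n) = d := by
  simp [snocWord]

@[simp] theorem snocWord_init_last {n : ℕ} (c : Fin (n + 1) → ℤ) :
    snocWord (Fin.init c) (c (Fin.last n)) = c := Fin.snoc_init_self c

theorem codeM_nonneg (n : ℕ) (c : Fin n → ℤ) : 0 ≤ codeM n c := by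
  induction n with
  | zero => exact le_rfl
  | succ n ih =>
    have := ih (Fin.init c)
    rw [codeM_succ]
    split_ifs <;> omega

theorem codeM_le {n : ℕ} {c : Fin n → ℤ} (hc : c ∈ RCodes n) : codeM n c ≤ n := by
  induction n with
  | zero => exact le_rfl
  | succ n ih =>
    obtain ⟨h1, h2, h3⟩ := mem_RCodes_succ.1 hc
    have := ih h1
    rw [codeM_succ]
    split_ifs <;> push_cast <;> omega

theorem lt_of_mem_colWord {n j : ℕ} {d : ℤ} (hd : -n ≤ d) (hj : j ∈ colWord n d) : j ≤ n := by
  unfold colWord at hj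
  split_ifs at hj
  · simp at hj
  · simp only [List.mem_reverse, List.mem_range'_1] at hj; omega
  · simp only [List.mem_append, List.mem_reverse, List.mem_range, List.mem_range'_1] at hj; omega

theorem lt_of_mem_codeWord {n j : ℕ} {c : Fin n → ℤ} (hc : c ∈ RCodes n) (hj : j ∈ codeWord n c) :
    j < n := by
  induction n with
  | zero => simp [codeWord] at hj
  | succ n ih =>
    obtain ⟨h1, h2, h3⟩ := mem_RCodes_succ.1 hc
    rcases List.mem_append.1 hj with hj | hj
    · have := ih h1 hj; omega
    · have := codeM_le h1
      have := lt_of_mem_colWord (by omega) hj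
      omega

/-- The one case of the action on R-codes that is not a computation inside the last column: if the
new zero is inserted right before the first zero of the earlier columns, exchanging the two changes
nothing. When the last column of `c` inserts a nonzero letter, the two insertions are interchanged,
which leaves a factor `g (k + 1)` that commutes with all earlier columns, and induction applies. -/
theorem RookRelations.codeProd_absorb (h : RookRelations N g) {k i : ℕ} {c : Fin k → ℤ}
    (hc : c ∈ RCodes k) (hk : k < N) (hi : i < k) (hm : codeM k c = i) :
    codeProd g k c * (down g 0 (k + 1) * up g 1 (i + 1)) =
      codeProd g k c * (down g 0 (k + 1) * up g 1 i) := by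
  induction k generalizing i with
  | zero => omega
  | succ k ih =>
    obtain ⟨h1, h2, h3⟩ := mem_RCodes_succ.1 hc
    have hm0 := codeM_nonneg k (Fin.init c)
    rw [codeM_succ] at hm
    rw [codeProd_succ]
    rcases le_or_gt (c (Fin.last k)) 0 with hd | hd
    · rw [if_pos hd] at hm
      rw [show c (Fin.last k) = -(i : ℤ) by omega, wordProd_colWord_neg, mul_assoc,
        h.col_mul_col hi hk, ← mul_assoc]
    · rw [if_neg (by omega)] at hm
      obtain ⟨d, hd'⟩ : ∃ d : ℕ, c (Fin.last k) = d := ⟨(c (Fin.last k)).toNat, by omega⟩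
      rw [hd'] at hm hd h3 ⊢
      have hslide : ∀ x y, codeProd g k (Fin.init c) * (g (k + 1) * x * y) =
          g (k + 1) * (codeProd g k (Fin.init c) * x) * y := by
        intro x y
        have : codeProd g k (Fin.init c) * g (k + 1) = g (k + 1) * codeProd g k (Fin.init c) := by
          refine h.commute_wordProd hk fun j hj => ?_
          have := lt_of_mem_codeWord h1 hj
          omega
        simp only [← mul_assoc, this]
      rw [wordProd_colWord_pos (by omega)]
      split_ifs at hm with hdm
      · obtain ⟨i, rfl⟩ : ∃ i', i = i' + 1 := ⟨i - 1, by omega⟩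
        have := ih h1 (i := i) (by omega) (by omega) (by push_cast at hm; omega)
        rw [mul_assoc, mul_assoc, h.down_mul_col_le (by omega) (by omega) (by omega) hk,
          h.down_mul_col_le (by omega) (by omega) (by omega) hk, hslide, hslide]
        simp only [Nat.add_sub_cancel]
        rw [this]
      · have := ih h1 (i := i) (by omega) (by omega) (by omega)
        rw [mul_assoc, mul_assoc, h.down_mul_col_lt (by omega) hk,
          h.down_mul_col_lt (by omega) hk, hslide, hslide, this]

/-! ### The action of the generators on R-codes -/

theorem codeAct_succ_pos (q : ℤ) {n : ℕ} {c : Fin (n + 1) → ℤ} (t : ℕ)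
    (hd : 1 ≤ c (Fin.last n)) :
    codeAct q (n + 1) c t =
      if (t : ℤ) = c (Fin.last n) then snocWord (Fin.init c) (c (Fin.last n) + q)
      else if (t : ℤ) = c (Fin.last n) - 1 then snocWord (Fin.init c) (c (Fin.last n) - 1)
      else if (t : ℤ) < c (Fin.last n) - 1 then
        snocWord (codeAct q n (Fin.init c) t) (c (Fin.last n))
      else snocWord (codeAct q n (Fin.init c) (t - 1)) (c (Fin.last n)) := by
  rw [codeAct, if_pos hd]

theorem codeAct_succ_nonpos (q : ℤ) {n : ℕ} {c : Fin (n + 1) → ℤ} (t : ℕ) {i : ℕ}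
    (hd : c (Fin.last n) = -(i : ℤ)) :
    codeAct q (n + 1) c t =
      if t = 0 then snocWord ((List.range i).foldl (codeAct q n) (Fin.init c)) 0
      else if t < i then snocWord (codeAct q n (Fin.init c) t) (-(i : ℤ))
      else if t = i then snocWord (Fin.init c) (-(i : ℤ) + q)
      else if t = i + 1 then
        if codeM n (Fin.init c) = i then c else snocWord (Fin.init c) (-((i : ℤ) + 1))
      else snocWord (codeAct q n (Fin.init c) (t - 1)) (-(i : ℤ)) := by
  rw [codeAct, if_neg (by omega), hd]
  simp only [neg_neg, Int.toNat_natCast]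

/-- The action of a letter `t ≥ 1` lowers `m` by at most one, and only if `t = m(c)`. This keeps the
last letter of an R-code admissible when the action is passed on to its prefix. -/
theorem codeM_codeAct {q : ℤ} (hq : q = 0 ∨ q = 1) {n : ℕ} {c : Fin n → ℤ} {t : ℕ}
    (ht : 1 ≤ t) :
    codeM n c - 1 ≤ codeM n (codeAct q n c t) ∧
      ((t : ℤ) ≠ codeM n c → codeM n c ≤ codeM n (codeAct q n c t)) := by
  induction n generalizing t with
  | zero => simp [codeM]
  | succ n ih =>
    have hm0 := codeM_nonneg n (Fin.init c)
    rcases lt_or_ge 0 (c (Fin.last n)) with hd | hd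
    · rw [codeAct_succ_pos q t hd]
      simp only [codeM_succ]
      split_ifs <;> simp only [snocWord_last, init_snocWord] at * <;> try omega
      all_goals
        first
        | have := ih (c := Fin.init c) (t := t) ht; omega
        | have := ih (c := Fin.init c) (t := t - 1) (by omega); omega
    · obtain ⟨i, hi⟩ : ∃ i : ℕ, c (Fin.last n) = -(i : ℤ) := ⟨(-c (Fin.last n)).toNat, by omega⟩
      rw [codeAct_succ_nonpos q t hi]
      simp only [codeM_succ]
      split_ifs <;> (try simp only [snocWord_last, init_snocWord] at *) <;> omega

theorem length_colWord_pos {n d : ℕ} (hd : d ≤ n + 1) : (colWord n d).length = n + 1 - d := by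
  unfold colWord
  split_ifs with h
  · simp; omega
  · simp
  · omega

theorem length_colWord_neg (n i : ℕ) : (colWord n (-(i : ℤ))).length = n + 1 + i := by
  unfold colWord
  rw [if_neg (by omega)]
  split_ifs with h
  · simp; omega
  · simp

/-- The letter `0` merges with the column of a zero: the zero goes to the first position, and the
letters it had been moved across become letters acting before the column. -/
theorem RookRelations.col_mul_zero (h : RookRelations N g) {k i : ℕ} (hi : i ≤ k) (hk : k < N) :
    down g 0 (k + 1) * up g 1 i * g 0 = up g 0 i * down g 0 (k + 1) := by
  rcases i with _ | i
  · have e3 : down g 0 (k + 1) = down g 1 k * g 0 := down_succ' 0 k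
    rw [up_zero, up_zero, mul_one, one_mul, e3, mul_assoc, h.zero_mul_zero (by omega)]
  · obtain ⟨k, rfl⟩ : ∃ k', k = k' + 1 := ⟨k - 1, by omega⟩
    have e1 : up g 1 (i + 1) = g 1 * up g 2 i := up_succ' 1 i
    have e2 : up g 0 (i + 1) = g 0 * up g 1 i := up_succ' 0 i
    have e3 : down g 0 (k + 1 + 1) = down g 2 k * g 1 * g 0 := by
      rw [down_succ', down_succ']
    have e4 : up g 2 i * g 0 = g 0 * up g 2 i := h.commute_up (by omega) (by omega) (by omega)
    have e5 : down g 2 k * g 0 = g 0 * down g 2 k :=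
      h.commute_down (by omega) (by omega) (by omega)
    have e6 : up g 1 i * down g 0 (k + 1 + 1) = down g 0 (k + 1 + 1) * up g 2 i :=
      h.up_mul_down (by omega) (by omega) (by omega) (by omega)
    rw [e2, mul_assoc (g 0), e6, e1]
    calc _ = down g 0 (k + 1 + 1) * g 1 * (up g 2 i * g 0) := by simp only [mul_assoc]
      _ = down g 2 k * (g 1 * g 0 * g 1 * g 0) * up g 2 i := by
        rw [e4, e3]; simp only [mul_assoc]
      _ = (down g 2 k * g 0) * g 1 * g 0 * up g 2 i := by
        rw [h.one_zero (by omega)]; simp only [mul_assoc]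
      _ = _ := by rw [e5, e3]; simp only [mul_assoc]

/-- The action on R-codes is right multiplication of canonical words, for both values of `q`. -/
theorem RookRelations.codeAct_spec (h : RookRelations N g) {q : ℤ}
    (hq : (q = 0 ∧ ∀ t, 1 ≤ t → t < N → g t * g t = g t) ∨
      (q = 1 ∧ ∀ t, 1 ≤ t → t < N → g t * g t = 1)) {n : ℕ} (hn : n ≤ N) {c : Fin n → ℤ}
    (hc : c ∈ RCodes n) {t : ℕ} (ht : t < n) :
    codeAct q n c t ∈ RCodes n ∧ codeProd g n (codeAct q n c t) = codeProd g n c * g t ∧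
      (codeWord n (codeAct q n c t)).length ≤ (codeWord n c).length + 1 := by
  have hq' : q = 0 ∨ q = 1 := hq.imp And.left And.left
  induction n generalizing t with
  | zero => omega
  | succ n ih =>
    have ih := fun {c} hc {t} ht => ih (by omega) (c := c) hc (t := t) ht
    obtain ⟨h1, h2, h3⟩ := mem_RCodes_succ.1 hc
    have hm0 := codeM_nonneg n (Fin.init c)
    have hmn := codeM_le h1
    have snoc_case : ∀ {c' : Fin n → ℤ} {d : ℤ}, c' ∈ RCodes n → -codeM n c' ≤ d → d ≤ n + 1 →
        codeProd g n c' * wordProd g (colWord n d) =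
          codeProd g n (Fin.init c) * wordProd g (colWord n (c (Fin.last n))) * g t →
        (codeWord n c').length + (colWord n d).length ≤
          (codeWord n (Fin.init c)).length + (colWord n (c (Fin.last n))).length + 1 →
        snocWord c' d ∈ RCodes (n + 1) ∧
          codeProd g (n + 1) (snocWord c' d) = codeProd g (n + 1) c * g t ∧
          (codeWord (n + 1) (snocWord c' d)).length ≤ (codeWord (n + 1) c).length + 1 := by
      intro c' d h1 h2 h3 h4 h5
      rw [mem_RCodes_succ, codeProd_succ, codeProd_succ, codeWord, codeWord, init_snocWord,
        snocWord_last, List.length_append, List.length_append]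
      exact ⟨⟨h1, h2, h3⟩, h4, h5⟩
    rcases lt_or_ge 0 (c (Fin.last n)) with hd | hd
    · rw [codeAct_succ_pos q t hd]
      obtain ⟨d, hd'⟩ : ∃ d : ℕ, c (Fin.last n) = d := ⟨(c (Fin.last n)).toNat, by omega⟩
      rw [hd'] at hd h3 h2 snoc_case ⊢
      rw [wordProd_colWord_pos (by omega), length_colWord_pos (by omega)] at snoc_case
      split_ifs with c1 c2 c3
      · obtain rfl : t = d := by omega
        rcases hq with ⟨rfl, hq⟩ | ⟨rfl, hq⟩
        · rw [add_zero]
          refine snoc_case h1 (by omega) (by omega) ?_ ?_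
          · rw [wordProd_colWord_pos (by omega), show n + 1 - t = n - t + 1 by omega, down_succ',
              mul_assoc, mul_assoc, hq t (by omega) (by omega)]
          · rw [length_colWord_pos (by omega)]; omega
        · rw [← Nat.cast_succ]
          refine snoc_case h1 (by push_cast; omega) (by push_cast; omega) ?_ ?_
          · rw [wordProd_colWord_pos (by omega), show n + 1 - t = n - t + 1 by omega, down_succ',
              mul_assoc, mul_assoc, hq t (by omega) (by omega), mul_one, Nat.add_sub_add_right]
          · rw [length_colWord_pos (by omega)]; omega
      · obtain ⟨d, rfl⟩ : ∃ d', d = d' + 1 := ⟨d - 1, by omega⟩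
        obtain rfl : t = d := by omega
        rw [← c2]
        refine snoc_case h1 (by omega) (by omega) ?_ ?_
        · rw [wordProd_colWord_pos (by omega), mul_assoc, show n + 1 - t = n - t + 1 by omega,
            down_succ', Nat.add_sub_add_right]
        · rw [length_colWord_pos (by omega)]; omega
      · obtain ⟨i1, i2, i3⟩ := ih h1 (t := t) (by omega)
        have := codeM_nonneg n (codeAct q n (Fin.init c) t)
        refine snoc_case i1 (by omega) (by omega) ?_ ?_
        · rw [wordProd_colWord_pos (by omega), i2, mul_assoc, mul_assoc,
            (h.commute_down (by omega) (by omega) (by omega) : Commute (down g d _) (g t)).eq]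
        · rw [length_colWord_pos (by omega)]; omega
      · obtain ⟨i1, i2, i3⟩ := ih h1 (t := t - 1) (by omega)
        have := codeM_nonneg n (codeAct q n (Fin.init c) (t - 1))
        refine snoc_case i1 (by omega) (by omega) ?_ ?_
        · rw [wordProd_colWord_pos (by omega), i2, mul_assoc, mul_assoc,
            h.down_mul_gen (by omega) (by omega) (by omega) (by omega)]
        · rw [length_colWord_pos (by omega)]; omega
    · obtain ⟨i, hi⟩ : ∃ i : ℕ, c (Fin.last n) = -(i : ℤ) := ⟨(-c (Fin.last n)).toNat, by omega⟩
      rw [codeAct_succ_nonpos q t hi]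
      rw [hi] at hd h3 h2 snoc_case
      rw [wordProd_colWord_neg, length_colWord_neg] at snoc_case
      split_ifs with c1 c2 c3 c4 c5
      · subst c1
        have fold : ∀ p ≤ i, ∀ c', c' = (List.range p).foldl (codeAct q n) (Fin.init c) →
            c' ∈ RCodes n ∧ codeProd g n c' = codeProd g n (Fin.init c) * up g 0 p ∧
              (codeWord n c').length ≤ (codeWord n (Fin.init c)).length + p := by
          intro p hp
          induction p with
          | zero => rintro c' rfl; simpa [up_zero] using h1
          | succ p ihp =>
            rintro c' rfl
            obtain ⟨j1, j2, j3⟩ := ihp (by omega) _ rfl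
            rw [List.range_succ, List.foldl_append, List.foldl_cons, List.foldl_nil]
            obtain ⟨i1, i2, i3⟩ := ih j1 (t := p) (by omega)
            refine ⟨i1, ?_, by omega⟩
            rw [i2, j2, up_succ, mul_assoc, zero_add]
        obtain ⟨j1, j2, j3⟩ := fold i le_rfl _ rfl
        have := codeM_nonneg n ((List.range i).foldl (codeAct q n) (Fin.init c))
        have e1 := wordProd_colWord_neg (g := g) n 0
        have e2 := length_colWord_neg n 0
        rw [Nat.cast_zero, neg_zero] at e1 e2
        refine snoc_case j1 (by omega) (by omega) ?_ ?_
        · rw [e1, j2, up_zero, mul_one, mul_assoc, mul_assoc,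
            h.col_mul_zero (by omega) (by omega)]
        · rw [e2]; omega
      · obtain ⟨i1, i2, i3⟩ := ih h1 (t := t) (by omega)
        have := codeM_codeAct hq' (n := n) (c := Fin.init c) (t := t) (by omega)
        refine snoc_case i1 (by omega) (by omega) ?_ ?_
        · have e1 : up g 1 i * g t = g (t + 1) * up g 1 i :=
            h.up_mul_gen (by omega) (by omega) (by omega) (by omega)
          have e2 : down g 0 (n + 1) * g (t + 1) = g t * down g 0 (n + 1) :=
            h.down_mul_gen (by omega) (by omega) (by omega) (by omega)
          rw [wordProd_colWord_neg, i2, mul_assoc, mul_assoc, mul_assoc, e1, ← mul_assoc (g t),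
            ← e2, mul_assoc]
        · rw [length_colWord_neg]; omega
      · subst c3
        obtain ⟨t, rfl⟩ : ∃ t', t = t' + 1 := ⟨t - 1, by omega⟩
        rcases hq with ⟨rfl, hq⟩ | ⟨rfl, hq⟩
        · rw [add_zero]
          refine snoc_case h1 (by omega) (by omega) ?_ ?_
          · rw [wordProd_colWord_neg, up_succ, add_comm 1 t]
            simp only [mul_assoc]
            rw [hq _ (by omega) (by omega)]
          · rw [length_colWord_neg]; omega
        · rw [show -((t + 1 : ℕ) : ℤ) + 1 = -(t : ℤ) by push_cast; ring]
          refine snoc_case h1 (by omega) (by omega) ?_ ?_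
          · rw [wordProd_colWord_neg, up_succ, add_comm 1 t]
            simp only [mul_assoc]
            rw [hq _ (by omega) (by omega), mul_one]
          · rw [length_colWord_neg]; omega
      · subst c4
        have := snoc_case h1 (by omega) (by omega) (d := -(i : ℤ)) ?_ ?_
        · rwa [← hi, snocWord_init_last] at this
        · rw [wordProd_colWord_neg, mul_assoc, mul_assoc, add_comm i 1, ← up_succ,
            h.codeProd_absorb h1 (by omega) (by omega) c5]
        · rw [length_colWord_neg]; omega
      · subst c4
        rw [← Nat.cast_succ]
        refine snoc_case h1 (by push_cast; omega) (by omega) ?_ ?_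
        · rw [wordProd_colWord_neg, mul_assoc, mul_assoc, up_succ, add_comm 1 i]
        · rw [length_colWord_neg]; omega
      · obtain ⟨i1, i2, i3⟩ := ih h1 (t := t - 1) (by omega)
        have := codeM_codeAct hq' (n := n) (c := Fin.init c) (t := t - 1) (by omega)
        refine snoc_case i1 (by omega) (by omega) ?_ ?_
        · have e1 : up g 1 i * g t = g t * up g 1 i :=
            h.commute_up (by omega) (by omega) (by omega)
          have e2 : down g 0 (n + 1) * g t = g (t - 1) * down g 0 (n + 1) :=
            h.down_mul_gen (by omega) (by omega) (by omega) (by omega)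
          rw [wordProd_colWord_neg, i2, mul_assoc, mul_assoc, mul_assoc, e1, ← mul_assoc _ (g t),
            e2, mul_assoc]
        · rw [length_colWord_neg]; omega

/-- Every element of the submonoid generated by the `g i` is the value of a canonical word. -/
theorem RookRelations.exists_code (h : RookRelations N g) {q : ℤ}
    (hq : (q = 0 ∧ ∀ t, 1 ≤ t → t < N → g t * g t = g t) ∨
      (q = 1 ∧ ∀ t, 1 ≤ t → t < N → g t * g t = 1)) {x : M}
    (hx : x ∈ Submonoid.closure (Set.range fun i : Fin N => g i)) :
    ∃ c ∈ RCodes N, codeProd g N c = x := by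
  induction hx using Submonoid.closure_induction_right with
  | one =>
    -- the R-code `1 2 ⋯ n`, all of whose columns are empty
    have key : ∀ n, (fun k : Fin n => (k : ℤ) + 1) ∈ RCodes n ∧
        codeProd g n (fun k : Fin n => (k : ℤ) + 1) = 1 := by
      intro n
      induction n with
      | zero => exact ⟨trivial, by simp [codeProd, codeWord, wordProd]⟩
      | succ n ih =>
        have e : Fin.init (fun k : Fin (n + 1) => (k : ℤ) + 1) = fun k : Fin n => (k : ℤ) + 1 := rfl
        have e2 := wordProd_colWord_pos (g := g) (n := n) (d := n + 1) le_rfl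
        rw [Nat.sub_self, down_zero] at e2
        push_cast at e2
        rw [codeProd_succ, mem_RCodes_succ, e, ih.2, one_mul, Fin.val_last, e2]
        have := codeM_nonneg n (fun k : Fin n => (k : ℤ) + 1)
        exact ⟨⟨ih.1, by omega, le_rfl⟩, rfl⟩
    exact ⟨_, key N⟩
  | mul_right x hx y hy ih =>
    obtain ⟨c, hc, rfl⟩ := ih
    obtain ⟨t, rfl⟩ := hy
    obtain ⟨h1, h2, -⟩ := h.codeAct_spec hq le_rfl hc t.2
    exact ⟨_, h1, h2⟩

/-! ### The elements `P_i` and the presentation of `G_n^0` -/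

/-- The elements `P_0 = 1`, `P_{i+1} = P_i π_i P_i`, where `π_i` is the value of `g` at `i`.
Since `P_0 = 1`, this gives `P_1 = π_0`. -/
def killer (g : ℕ → M) : ℕ → M
  | 0 => 1
  | i + 1 => killer g i * g i * killer g i

namespace RookRelations

/-- The relations are invariant under reversal of words. -/
theorem op (h : RookRelations N g) : RookRelations N (fun i => MulOpposite.op (g i)) where
  zero_mul_zero h0 := congrArg MulOpposite.op (h.zero_mul_zero h0)
  braid i h1 h2 := by
    simp only [← MulOpposite.op_mul, ← mul_assoc]
    rw [h.braid i h1 h2]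
  comm i j h1 h2 := congrArg MulOpposite.op (h.comm i j h1 h2).symm
  one_zero h1 := by
    simp only [← MulOpposite.op_mul, ← mul_assoc]
    rw [h.zero_one h1]
  zero_one h1 := by
    simp only [← MulOpposite.op_mul, ← mul_assoc]
    rw [h.one_zero h1]

theorem killer_op (i : ℕ) :
    killer (fun i => MulOpposite.op (g i)) i = MulOpposite.op (killer g i) := by
  induction i with
  | zero => rfl
  | succ i ih => rw [killer, killer, ih, mul_assoc]; rfl

variable (h : RookRelations N g)
include h

theorem killer_comm {i j : ℕ} (hij : i < j) (hj : j < N) : Commute (killer g i) (g j) := by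
  induction i with
  | zero => exact Commute.one_left _
  | succ i ih =>
    have := ih (by omega)
    exact (this.mul_left (h.comm i j hj (by omega))).mul_left this

/-- `P_i` is idempotent and absorbs `π_0, …, π_{i-1}` on the right. For `P_{i+1} π_i` with `i ≥ 2`,
expanding the last factor `P_i` and using the braid relation brings a letter `π_{i-1}` next to the
first factor `P_i`, which absorbs it. -/
theorem killer_idem_and_mul_gen {i : ℕ} (hi : i ≤ N) :
    (∀ k ≤ i, killer g k * killer g k = killer g k) ∧
      ∀ j < i, killer g i * g j = killer g i := by
  induction i with
  | zero =>
    refine ⟨fun k hk => ?_, fun j hj => by omega⟩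
    rw [Nat.le_zero.1 hk]
    exact one_mul _
  | succ i ih =>
    obtain ⟨ih1, ih2⟩ := ih (by omega)
    have last : killer g (i + 1) * g i = killer g (i + 1) := by
      rcases i with _ | i
      · simpa [killer] using h.zero_mul_zero hi
      set Q := killer g i with hQ
      set R := killer g (i + 1) with hR
      have hRQ : R = Q * g i * Q := rfl
      have hcomm : Q * g (i + 1) = g (i + 1) * Q := h.killer_comm (by omega) (by omega)
      rcases i with _ | i
      · have := h.zero_one hi
        simpa [killer, hR] using this
      have hRR : R * Q = R := by
        rw [hRQ, mul_assoc]
        rw [ih1 _ (by omega)]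
      change R * g (i + 1 + 1) * R * g (i + 1 + 1) = R * g (i + 1 + 1) * R
      have e : R * g (i + 1 + 1) * R = R * g (i + 1 + 1) * g (i + 1) * Q := by
        calc _ = R * g (i + 1 + 1) * Q * g (i + 1) * Q := by
              conv_lhs => rw [mul_assoc _ _ R]
              nth_rw 2 [hRQ]
              simp only [mul_assoc]
          _ = R * Q * g (i + 1 + 1) * g (i + 1) * Q := by
              rw [mul_assoc R, ← hcomm]; simp only [mul_assoc]
          _ = _ := by rw [hRR]
      rw [e]
      calc _ = R * (g (i + 1 + 1) * g (i + 1) * g (i + 1 + 1)) * Q := by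
            rw [mul_assoc _ Q, hcomm]; simp only [mul_assoc]
        _ = R * g (i + 1) * g (i + 1 + 1) * g (i + 1) * Q := by
            rw [← h.braid (i + 1) (by omega) hi]; simp only [mul_assoc]
        _ = _ := by rw [ih2 _ (by omega)]
    have hmul : killer g (i + 1) * killer g i = killer g (i + 1) := by
      rw [killer, mul_assoc, ih1 i le_rfl]
    refine ⟨fun k hk => ?_, fun j hj => ?_⟩
    · rcases Nat.le_succ_iff.1 hk with hk | rfl
      · exact ih1 k hk
      · conv_lhs => rw [killer.eq_2 g i]
        change killer g (i + 1) * _ = _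
        rw [← mul_assoc, ← mul_assoc, hmul, last, hmul]
    · rcases Nat.lt_succ_iff_lt_or_eq.1 hj with hj | rfl
      · rw [killer, mul_assoc, ih2 j hj]
      · exact last

theorem killer_mul_self {i : ℕ} (hi : i ≤ N) : killer g i * killer g i = killer g i :=
  (h.killer_idem_and_mul_gen hi).1 i le_rfl

theorem killer_mul_gen {i j : ℕ} (hi : i ≤ N) (hj : j < i) : killer g i * g j = killer g i :=
  (h.killer_idem_and_mul_gen hi).2 j hj

/-- The absorption on the left is the one on the right in the opposite monoid. -/
theorem gen_mul_killer {i j : ℕ} (hi : i ≤ N) (hj : j < i) : g j * killer g i = killer g i := by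
  have := h.op.killer_mul_gen hi hj
  rw [killer_op] at this
  exact MulOpposite.op_injective this

theorem killer_mul_killer {i j : ℕ} (hij : i ≤ j) (hj : j ≤ N) :
    killer g i * killer g j = killer g j ∧ killer g j * killer g i = killer g j := by
  induction i with
  | zero => exact ⟨one_mul _, mul_one _⟩
  | succ i ih =>
    obtain ⟨h1, h2⟩ := ih (by omega)
    rw [killer, mul_assoc, mul_assoc, h1, h.gen_mul_killer hj hij, h1, ← mul_assoc,
      ← mul_assoc, h2, h.killer_mul_gen hj hij, h2]
    exact ⟨rfl, rfl⟩

theorem lift_eq_of_RBRel (hsq : ∀ t, t < N → g t * g t = g t) (a b : FreeMonoid (Fin N))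
    (hab : RBRel N a b) :
    FreeMonoid.lift (fun i : Fin N => g i) a = FreeMonoid.lift (fun i : Fin N => g i) b := by
  induction hab with
  | rb1 i => simpa using hsq i i.2
  | rb2 i j hi hj =>
    have := j.2
    simpa [hj] using h.braid i hi (by omega)
  | rb3_left i j hi hj =>
    have := j.2
    simpa [hi, hj] using h.one_zero (by omega)
  | rb3_right i j hi hj =>
    have := j.2
    simpa [hi, hj] using (h.zero_one (by omega)).symm
  | rb4 i j hij => simpa using (h.commute_far i.2 j.2 hij).eq

theorem lift_eq_of_RsRel (hsq : ∀ t, 1 ≤ t → t < N → g t * g t = 1) (a b : FreeMonoid (Fin N))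
    (hab : RsRel N a b) :
    FreeMonoid.lift (fun i : Fin N => g i) a = FreeMonoid.lift (fun i : Fin N => g i) b := by
  induction hab with
  | rs1 i hi => simpa using hsq i hi i.2
  | rs2 i j hi hj =>
    have := j.2
    simpa [hj] using h.braid i hi (by omega)
  | rs3 i j hi hj hij => simpa using (h.commute_far i.2 j.2 hij).eq
  | rs4 p hp =>
    have := p.2
    simpa [hp] using h.zero_mul_zero (by omega)
  | rs5 p j hp hj hj1 => simpa using (h.commute_far p.2 j.2 (by omega)).eq
  | rs6_left p j hp hj =>
    have := j.2
    simpa [hp, hj] using h.one_zero (by omega)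
  | rs6_right p j hp hj =>
    have := j.2
    simpa [hp, hj] using (h.zero_one (by omega)).symm

end RookRelations
end Words

/-- The generators of the monoid presented by RB1 – RB4, with the value `1` at unused indices. -/
def rbGen (n i : ℕ) : PresentedMonoid (RBRel n) :=
  if h : i < n then PresentedMonoid.of (RBRel n) ⟨i, h⟩ else 1

theorem rbGen_sq {n : ℕ} (t : ℕ) (ht : t < n) : rbGen n t * rbGen n t = rbGen n t := by
  simp only [rbGen, ht, dif_pos]
  exact PresentedMonoid.mk_eq_mk_of_rel (.rb1 _)

theorem rookRelations_rbGen (n : ℕ) : RookRelations n (rbGen n) where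
  zero_mul_zero h := rbGen_sq 0 h
  braid i h1 h2 := by
    simp only [rbGen, h2, dif_pos, show i < n by omega]
    exact PresentedMonoid.mk_eq_mk_of_rel (.rb2 _ _ h1 rfl)
  comm i j h1 h2 := by
    simp only [rbGen, h1, dif_pos, show i < n by omega]
    exact PresentedMonoid.mk_eq_mk_of_rel (.rb4 _ _ (Or.inl h2))
  one_zero h := by
    simp only [rbGen, h, dif_pos, show 0 < n by omega]
    exact PresentedMonoid.mk_eq_mk_of_rel (.rb3_left _ _ rfl rfl)
  zero_one h := by
    simp only [rbGen, h, dif_pos, show 0 < n by omega]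
    exact (PresentedMonoid.mk_eq_mk_of_rel (.rb3_right _ _ rfl rfl)).symm

theorem s1_sq {n : ℕ} (t : ℕ) (h1 : 1 ≤ t) (ht : t < n) : s1 n t * s1 n t = 1 := by
  simp only [s1, ht, dif_pos]
  exact PresentedMonoid.mk_eq_mk_of_rel (.rs1 _ h1)

theorem rookRelations_s1 (n : ℕ) : RookRelations n (s1 n) where
  zero_mul_zero h := by
    simp only [s1, h, dif_pos]
    exact PresentedMonoid.mk_eq_mk_of_rel (.rs4 _ rfl)
  braid i h1 h2 := by
    simp only [s1, h2, dif_pos, show i < n by omega]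
    exact PresentedMonoid.mk_eq_mk_of_rel (.rs2 _ _ h1 rfl)
  comm i j h1 h2 := by
    simp only [s1, h1, dif_pos, show i < n by omega]
    rcases Nat.eq_zero_or_pos i with rfl | hi
    · exact PresentedMonoid.mk_eq_mk_of_rel (.rs5 _ _ rfl (by simp; omega) (by simp; omega))
    · exact PresentedMonoid.mk_eq_mk_of_rel (.rs3 _ _ hi (by simp; omega) (Or.inl h2))
  one_zero h := by
    simp only [s1, h, dif_pos, show 0 < n by omega]
    exact PresentedMonoid.mk_eq_mk_of_rel (.rs6_left _ _ rfl rfl)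
  zero_one h := by
    simp only [s1, h, dif_pos, show 0 < n by omega]
    exact (PresentedMonoid.mk_eq_mk_of_rel (.rs6_right _ _ rfl rfl)).symm

/-- The value of Halverson's generators in a monoid with elements `π_0, …, π_{n-1}`. -/
def halversonGen {M : Type*} [Monoid M] {n : ℕ} (g : ℕ → M) : HGen n → M
  | .pi i _ => g i
  | .P i _ => killer g i

theorem RookRelations.lift_eq_of_HRel {M : Type*} [Monoid M] {g : ℕ → M} {n : ℕ}
    (h : RookRelations n g) (hsq : ∀ t, 1 ≤ t → t < n → g t * g t = g t)
    (a b : FreeMonoid (HGen n)) (hab : HRel n a b) :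
    FreeMonoid.lift (halversonGen g) a = FreeMonoid.lift (halversonGen g) b := by
  induction hab with
  | r1 i hi => simpa [wpi, halversonGen] using hsq i hi.1 hi.2
  | r2 i hi hj => simpa [wpi, halversonGen] using h.braid i hi.1 hj.2
  | r3 i j hi hj hij => simpa [wpi, halversonGen] using (h.commute_far hi.2 hj.2 hij).eq
  | r4 i hi => simpa [wP, halversonGen] using h.killer_mul_self hi.2
  | r5 i j hi hj =>
    rcases le_total i j with hij | hij
    · have := h.killer_mul_killer hij hj.2
      simpa [wP, halversonGen] using this.1.trans this.2.symm
    · have := h.killer_mul_killer hij hi.2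
      simpa [wP, halversonGen] using this.2.trans this.1.symm
  | r6 i j hi hj hij => simpa [wP, wpi, halversonGen] using (h.killer_comm hij hj.2).eq
  | r7_right i j hi hj hij =>
    simpa [wP, wpi, halversonGen] using h.killer_mul_gen hi.2 hij
  | r7_left i j hi hj hij =>
    simpa [wP, wpi, halversonGen] using h.gen_mul_killer hi.2 hij
  | r8 i hp hi hj => simp [wP, wpi, halversonGen, killer]

theorem pi0_eq {n i : ℕ} (h : 1 ≤ i ∧ i < n) :
    pi0 n i = PresentedMonoid.of (HRel n) (HGen.pi i h) := by
  rw [pi0, dif_pos h.2, dif_neg (by omega)]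

theorem pi0_zero {n : ℕ} (h : 0 < n) :
    pi0 n 0 = PresentedMonoid.of (HRel n) (HGen.P 1 ⟨le_rfl, h⟩) := by
  rw [pi0, dif_pos h, dif_pos rfl]

theorem pi0_sq {n : ℕ} (t : ℕ) (ht : t < n) : pi0 n t * pi0 n t = pi0 n t := by
  rcases Nat.eq_zero_or_pos t with rfl | h
  · rw [pi0_zero ht]
    exact PresentedMonoid.mk_eq_mk_of_rel (.r4 _ _)
  · rw [pi0_eq ⟨h, ht⟩]
    exact PresentedMonoid.mk_eq_mk_of_rel (.r1 _ _)

theorem P_two_eq {n : ℕ} (h : 1 < n) : PresentedMonoid.of (HRel n) (HGen.P 2 ⟨by omega, h⟩) =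
    pi0 n 0 * pi0 n 1 * pi0 n 0 := by
  rw [pi0_zero (by omega), pi0_eq ⟨le_rfl, h⟩]
  exact PresentedMonoid.mk_eq_mk_of_rel (.r8 1 ⟨le_rfl, h⟩ _ _)

theorem rookRelations_pi0 (n : ℕ) : RookRelations n (pi0 n) where
  zero_mul_zero h := pi0_sq 0 h
  braid i h1 h2 := by
    rw [pi0_eq ⟨h1, by omega⟩, pi0_eq ⟨by omega, h2⟩]
    exact PresentedMonoid.mk_eq_mk_of_rel (.r2 _ _ _)
  comm i j h1 h2 := by
    rw [pi0_eq (i := j) ⟨by omega, h1⟩]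
    rcases Nat.eq_zero_or_pos i with rfl | hi
    · rw [pi0_zero (by omega)]
      exact PresentedMonoid.mk_eq_mk_of_rel (.r6 _ _ _ _ (by omega))
    · rw [pi0_eq ⟨hi, by omega⟩]
      exact PresentedMonoid.mk_eq_mk_of_rel (.r3 _ _ _ _ (Or.inl h2))
  one_zero h := by
    have e := P_two_eq h
    rw [mul_assoc, mul_assoc, ← mul_assoc (pi0 n 0), ← e, pi0_eq ⟨le_rfl, h⟩]
    exact PresentedMonoid.mk_eq_mk_of_rel (.r7_left _ _ _ _ (by omega))
  zero_one h := by
    rw [← P_two_eq h, pi0_eq ⟨le_rfl, h⟩]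
    exact PresentedMonoid.mk_eq_mk_of_rel (.r7_right _ _ _ _ (by omega))

theorem killer_pi0 {n i : ℕ} (h : 1 ≤ i ∧ i ≤ n) :
    killer (pi0 n) i = PresentedMonoid.of (HRel n) (HGen.P i h) := by
  obtain ⟨i, rfl⟩ : ∃ i', i = i' + 1 := ⟨i - 1, by omega⟩
  induction i with
  | zero => simp only [killer, one_mul, mul_one]; exact pi0_zero (by omega)
  | succ i ih =>
    rw [killer, ih ⟨by omega, by omega⟩, pi0_eq ⟨by omega, by omega⟩]
    exact (PresentedMonoid.mk_eq_mk_of_rel (.r8 (i + 1) ⟨by omega, by omega⟩ _ _)).symm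

theorem map_killer {M M' : Type*} [Monoid M] [Monoid M'] (f : M →* M') (g : ℕ → M) (i : ℕ) :
    f (killer g i) = killer (fun j => f (g j)) i := by
  induction i with
  | zero => exact map_one f
  | succ i ih => simp only [killer, map_mul, ih]

theorem exists_equiv_RB (n : ℕ) : ∃ e : G0 n ≃* PresentedMonoid (RBRel n),
    ∀ i : Fin n, e (pi0 n i) = PresentedMonoid.of (RBRel n) i := by
  let φ : G0 n →* PresentedMonoid (RBRel n) := PresentedMonoid.lift (halversonGen (rbGen n))
    ((rookRelations_rbGen n).lift_eq_of_HRel fun t _ => rbGen_sq t)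
  let ψ : PresentedMonoid (RBRel n) →* G0 n := PresentedMonoid.lift (fun i : Fin n => pi0 n i)
    ((rookRelations_pi0 n).lift_eq_of_RBRel pi0_sq)
  have hψ : ∀ i < n, ψ (rbGen n i) = pi0 n i := by
    intro i hi
    rw [rbGen, dif_pos hi]
    exact PresentedMonoid.lift_of _ _
  have hφ : ∀ i : Fin n, φ (pi0 n i) = PresentedMonoid.of (RBRel n) i := by
    intro i
    have e : rbGen n i = PresentedMonoid.of (RBRel n) i := dif_pos i.2
    rcases Nat.eq_zero_or_pos (i : ℕ) with h0 | h0
    · have hn := i.2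
      rw [← e, h0, pi0_zero (by omega)]
      refine (PresentedMonoid.lift_of _ _).trans ?_
      simp [halversonGen, killer]
    · rw [← e, pi0_eq ⟨h0, i.2⟩]
      exact PresentedMonoid.lift_of _ _
  have hk : ∀ i ≤ n, killer (fun j => ψ (rbGen n j)) i = killer (pi0 n) i := by
    intro i hi
    induction i with
    | zero => rfl
    | succ i ih => rw [killer, ih (by omega), hψ i hi, killer]
  refine ⟨MonoidHom.toMulEquiv φ ψ ?_ ?_, hφ⟩
  · ext x
    rcases x with ⟨i, hi⟩ | ⟨i, hi⟩
    · exact (hψ i hi.2).trans (pi0_eq hi)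
    · exact ((map_killer ψ _ _).trans (hk i hi.2)).trans (killer_pi0 hi)
  · ext i
    exact hφ i

/-! ### Rook vectors as sequences -/

/-- The entries of a rook vector as an infinite sequence, continued by `j ↦ j + 1`. -/
def entries {n : ℕ} (r : RookVec n) (j : ℕ) : ℕ :=
  if h : j < n then (r.1 ⟨j, h⟩ : ℕ) else j + 1

/-- The sequences that come from rook vectors of size `n`. Because of the continuation by
`j ↦ j + 1`, the nonzero entries of the whole sequence are distinct. -/
structure IsRookSeq (n : ℕ) (f : ℕ → ℕ) : Prop where
  le : ∀ j < n, f j ≤ n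
  eq : ∀ j, n ≤ j → f j = j + 1
  inj : ∀ i j, f i = f j → f i ≠ 0 → i = j

theorem entries_of_lt {n : ℕ} (r : RookVec n) {j : ℕ} (h : j < n) : entries r j = r.1 ⟨j, h⟩ :=
  dif_pos h

theorem entries_of_ge {n : ℕ} (r : RookVec n) {j : ℕ} (h : n ≤ j) : entries r j = j + 1 :=
  dif_neg (by omega)

theorem entries_injective (n : ℕ) : Function.Injective (entries (n := n)) := by
  intro r r' h
  refine Subtype.ext (funext fun j => Fin.ext ?_)
  have := congrFun h j
  rwa [entries_of_lt r j.2, entries_of_lt r' j.2] at this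

theorem isRookSeq_entries {n : ℕ} (r : RookVec n) : IsRookSeq n (entries r) where
  le j hj := by rw [entries_of_lt r hj]; exact Nat.lt_succ_iff.1 (r.1 _).2
  eq j hj := entries_of_ge r hj
  inj i j h h0 := by
    rcases lt_or_ge i n with hi | hi <;> rcases lt_or_ge j n with hj | hj
    · rw [entries_of_lt r hi] at h h0
      rw [entries_of_lt r hj] at h
      have := r.2 _ _ (Fin.ext h) fun e => h0 (by rw [e]; rfl)
      exact Fin.mk.inj_iff.1 this
    · rw [entries_of_lt r hi, entries_of_ge r hj] at h
      have := (r.1 ⟨i, hi⟩).2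
      omega
    · rw [entries_of_ge r hi, entries_of_lt r hj] at h
      have := (r.1 ⟨j, hj⟩).2
      omega
    · rw [entries_of_ge r hi, entries_of_ge r hj] at h
      omega

/-- Put `x` at position `p`, moving the entries at the positions `p, …, k - 1` one step to the
right; the entry at position `k` is lost. -/
def insertSeq (p k x : ℕ) (f : ℕ → ℕ) (j : ℕ) : ℕ :=
  if j < p then f j else if j = p then x else if j ≤ k then f (j - 1) else f j

/-- The sequence of the rook vector with R-code `c`. -/
def codeVec : (n : ℕ) → (Fin n → ℤ) → ℕ → ℕ
  | 0, _ => fun j => j + 1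
  | n + 1, c =>
    if 0 < c (Fin.last n) then
      insertSeq (c (Fin.last n) - 1).toNat n (n + 1) (codeVec n (Fin.init c))
    else insertSeq (-c (Fin.last n)).toNat n 0 (codeVec n (Fin.init c))

theorem codeVec_pos {n p : ℕ} {c : Fin (n + 1) → ℤ} (h : c (Fin.last n) = p + 1) :
    codeVec (n + 1) c = insertSeq p n (n + 1) (codeVec n (Fin.init c)) := by
  rw [codeVec, if_pos (by omega)]
  congr 1; omega

theorem codeVec_neg {n p : ℕ} {c : Fin (n + 1) → ℤ} (h : c (Fin.last n) = -(p : ℤ)) :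
    codeVec (n + 1) c = insertSeq p n 0 (codeVec n (Fin.init c)) := by
  rw [codeVec, if_neg (by omega)]
  congr 1; omega

theorem RCode_cases {n : ℕ} {c : Fin (n + 1) → ℤ} (hc : c ∈ RCodes (n + 1)) :
    (∃ p : ℕ, p ≤ n ∧ c (Fin.last n) = p + 1) ∨
      ∃ p : ℕ, p ≤ codeM n (Fin.init c) ∧ c (Fin.last n) = -(p : ℤ) := by
  obtain ⟨h1, h2, h3⟩ := mem_RCodes_succ.1 hc
  rcases lt_or_ge 0 (c (Fin.last n)) with hd | hd
  · exact Or.inl ⟨(c (Fin.last n) - 1).toNat, by omega, by omega⟩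
  · exact Or.inr ⟨(-c (Fin.last n)).toNat, by omega, by omega⟩

theorem IsRookSeq.insertSeq {n p x : ℕ} {f : ℕ → ℕ} (hf : IsRookSeq n f) (hp : p ≤ n)
    (hx : x ≤ n + 1) (hfx : x ≠ 0 → ∀ j, j ≠ n → f j ≠ x) :
    IsRookSeq (n + 1) (insertSeq p n x f) where
  le j hj := by
    have h1 := hf.le j
    have h2 := hf.le (j - 1)
    unfold ZeroRook.insertSeq
    split_ifs <;> omega
  eq j hj := by
    have h1 := hf.eq j
    unfold ZeroRook.insertSeq
    split_ifs <;> omega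
  inj i j h h0 := by
    -- off `p`, the entry at `k` is the entry of `f` at a position `s ≠ n` determined by `k`
    have src : ∀ k, k ≠ p → ∃ s, s ≠ n ∧ ZeroRook.insertSeq p n x f k = f s ∧
        (k < p ∧ s = k ∨ p < k ∧ k ≤ n ∧ s = k - 1 ∨ n < k ∧ s = k) := by
      intro k hk
      unfold ZeroRook.insertSeq
      split_ifs with h1 h2
      · exact ⟨k, by omega, rfl, by omega⟩
      · exact ⟨k - 1, by omega, rfl, by omega⟩
      · exact ⟨k, by omega, rfl, by omega⟩
    have hpx : ZeroRook.insertSeq p n x f p = x := by simp [ZeroRook.insertSeq]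
    rcases eq_or_ne i p with rfl | hi <;> rcases eq_or_ne j i with rfl | hij
    · rfl
    · obtain ⟨s, s1, s2, -⟩ := src j hij
      rw [hpx] at h h0
      exact absurd (s2.symm.trans h.symm) (hfx h0 s s1)
    · rfl
    · obtain ⟨s, s1, s2, s3⟩ := src i hi
      rcases eq_or_ne j p with rfl | hj
      · rw [h, hpx] at h0
        exact absurd (s2.symm.trans (h.trans hpx)) (hfx h0 s s1)
      · obtain ⟨t, t1, t2, t3⟩ := src j hj
        rw [s2] at h0
        have := hf.inj s t (by rw [← s2, ← t2, h]) h0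
        omega

theorem isRookSeq_codeVec {n : ℕ} {c : Fin n → ℤ} (hc : c ∈ RCodes n) :
    IsRookSeq n (codeVec n c) := by
  induction n with
  | zero => exact ⟨fun j hj => by omega, fun j _ => rfl, fun i j h _ => Nat.succ_injective h⟩
  | succ n ih =>
    have h1 := (mem_RCodes_succ.1 hc).1
    rcases RCode_cases hc with ⟨p, hp, hd⟩ | ⟨p, hp, hd⟩
    · rw [codeVec_pos hd]
      have hs := ih h1
      refine hs.insertSeq hp le_rfl fun _ j hj => ?_
      have := hs.le j
      have := hs.eq j
      omega
    · rw [codeVec_neg hd]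
      have := codeM_le h1
      exact (ih h1).insertSeq (by omega) (by omega) fun h => absurd rfl h

/-- `m(c)` is the number of entries before the first zero of the rook vector with R-code `c`. -/
theorem codeVec_eq_zero {n : ℕ} {c : Fin n → ℤ} (hc : c ∈ RCodes n) {m : ℕ}
    (hm : codeM n c = m) : (m < n → codeVec n c m = 0) ∧ ∀ j < m, codeVec n c j ≠ 0 := by
  induction n generalizing m with
  | zero =>
    rw [codeM] at hm
    exact ⟨fun h => by omega, fun j hj => by omega⟩
  | succ n ih =>
    have h1 := (mem_RCodes_succ.1 hc).1
    have hle := codeM_le h1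
    obtain ⟨m', hm'⟩ : ∃ m' : ℕ, codeM n (Fin.init c) = m' :=
      Int.eq_ofNat_of_zero_le (codeM_nonneg _ _)
    obtain ⟨i1, i2⟩ := ih h1 hm'
    have heq := (isRookSeq_codeVec h1).eq
    rw [codeM_succ] at hm
    rcases RCode_cases hc with ⟨p, hp, hd⟩ | ⟨p, hp, hd⟩
    · rw [codeVec_pos hd]
      rw [if_neg (by omega)] at hm
      unfold insertSeq
      refine ⟨fun hmn => ?_, fun j hj => ?_⟩
      · split_ifs at hm with h2
        · obtain rfl : m = m' + 1 := by omega
          rw [if_neg (by omega), if_neg (by omega), if_pos (by omega)]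
          exact i1 (by omega)
        · obtain rfl : m = m' := by omega
          rw [if_pos (by omega)]
          exact i1 (by omega)
      · have j1 := i2 j
        have j2 := i2 (j - 1)
        split_ifs at hm ⊢ <;> omega
    · rw [codeVec_neg hd]
      rw [if_pos (by omega)] at hm
      obtain rfl : m = p := by omega
      unfold insertSeq
      refine ⟨fun _ => by simp, fun j hj => ?_⟩
      rw [if_pos hj]
      exact i2 j (by omega)

theorem insertSeq_injective {n p x : ℕ} {f f' : ℕ → ℕ} (hf : IsRookSeq n f)
    (hf' : IsRookSeq n f') (h : insertSeq p n x f = insertSeq p n x f') : f = f' := by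
  funext j
  rcases lt_or_ge j n with hj | hj
  · rcases lt_or_ge j p with hjp | hjp
    · have := congrFun h j
      rwa [insertSeq, insertSeq, if_pos hjp, if_pos hjp] at this
    · have := congrFun h (j + 1)
      simp only [insertSeq] at this
      rwa [if_neg (by omega), if_neg (by omega), if_pos (by omega), if_neg (by omega),
        if_neg (by omega), if_pos (by omega)] at this
  · rw [hf.eq j hj, hf'.eq j hj]

theorem insertSeq_self (p n x : ℕ) (f : ℕ → ℕ) : insertSeq p n x f p = x := by
  simp [insertSeq]

theorem insertSeq_zero_le {n p : ℕ} {f : ℕ → ℕ} (hf : IsRookSeq n f) (hp : p ≤ n) {j : ℕ}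
    (hj : j ≤ n) : insertSeq p n 0 f j ≤ n := by
  have h1 := hf.le j
  have h2 := hf.le (j - 1)
  unfold insertSeq
  split_ifs <;> omega

/-- The last letter of `c` is determined by its rook vector: it is given by the position of the
letter `n + 1` or, if this does not occur, by the position of the first zero. -/
theorem codeVec_injOn {n : ℕ} {c c' : Fin n → ℤ} (hc : c ∈ RCodes n) (hc' : c' ∈ RCodes n)
    (h : codeVec n c = codeVec n c') : c = c' := by
  induction n with
  | zero => exact Subsingleton.elim _ _
  | succ n ih =>
    have h1 := (mem_RCodes_succ.1 hc).1
    have h1' := (mem_RCodes_succ.1 hc').1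
    have hs := isRookSeq_codeVec h1
    have hs' := isRookSeq_codeVec h1'
    have hle := codeM_le h1
    have hle' := codeM_le h1'
    suffices Fin.init c = Fin.init c' ∧ c (Fin.last n) = c' (Fin.last n) by
      rw [← snocWord_init_last c, ← snocWord_init_last c', this.1, this.2]
    have hinj := (isRookSeq_codeVec hc).inj
    rcases RCode_cases hc with ⟨p, hp, hd⟩ | ⟨p, hp, hd⟩ <;>
      rcases RCode_cases hc' with ⟨p', hp', hd'⟩ | ⟨p', hp', hd'⟩
    · rw [h, codeVec_pos hd'] at hinj
      rw [codeVec_pos hd, codeVec_pos hd'] at h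
      have e := congrFun h p
      rw [insertSeq_self] at e
      obtain rfl := hinj p p' (by rw [insertSeq_self, ← e]) (by omega)
      exact ⟨ih h1 h1' (insertSeq_injective hs hs' h), hd.trans hd'.symm⟩
    · rw [codeVec_pos hd, codeVec_neg hd'] at h
      have e := congrFun h p
      rw [insertSeq_self] at e
      have := insertSeq_zero_le hs' (p := p') (by omega) hp
      omega
    · rw [codeVec_neg hd, codeVec_pos hd'] at h
      have e := congrFun h p'
      rw [insertSeq_self] at e
      have := insertSeq_zero_le hs (p := p) (by omega) hp'
      omega
    · have hm : codeM (n + 1) c = p := by rw [codeM_succ, if_pos (by omega)]; omega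
      have hm' : codeM (n + 1) c' = p' := by rw [codeM_succ, if_pos (by omega)]; omega
      obtain ⟨z1, z2⟩ := codeVec_eq_zero hc hm
      obtain ⟨z1', z2'⟩ := codeVec_eq_zero hc' hm'
      rw [h] at z1 z2
      obtain rfl : p = p' := by
        rcases lt_trichotomy p p' with hlt | heq | hlt
        · exact absurd (z1 (by omega)) (z2' p hlt)
        · exact heq
        · exact absurd (z1' (by omega)) (z2 p' hlt)
      rw [codeVec_neg hd, codeVec_neg hd'] at h
      exact ⟨ih h1 h1' (insertSeq_injective hs hs' h), hd.trans hd'.symm⟩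

/-- Remove the entry at position `p` among the positions `0, …, n`; from position `n` on the
sequence continues by `j ↦ j + 1`. -/
def removeSeq (p n : ℕ) (f : ℕ → ℕ) (j : ℕ) : ℕ :=
  if j < p then f j else if j < n then f (j + 1) else j + 1

theorem insertSeq_removeSeq {n p : ℕ} {f : ℕ → ℕ} (hf : IsRookSeq (n + 1) f) :
    insertSeq p n (f p) (removeSeq p n f) = f := by
  funext j
  have := hf.eq j
  unfold insertSeq removeSeq
  split_ifs with h1 h2 h3 h4 h5
  all_goals first
    | rfl
    | omega
    | (rw [h2])
    | (congr 1; omega)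

theorem IsRookSeq.removeSeq {n p : ℕ} {f : ℕ → ℕ} (hf : IsRookSeq (n + 1) f) (hp : p ≤ n)
    (hle : ∀ j ≤ n, j ≠ p → f j ≤ n) : IsRookSeq n (removeSeq p n f) where
  le j hj := by
    have h1 := hle j
    have h2 := hle (j + 1)
    unfold ZeroRook.removeSeq
    split_ifs <;> omega
  eq j hj := by
    unfold ZeroRook.removeSeq
    split_ifs <;> omega
  inj i j h h0 := by
    unfold ZeroRook.removeSeq at h h0
    have := hf.inj i j
    have := hf.inj (i + 1) j
    have := hf.inj i (j + 1)
    have := hf.inj (i + 1) (j + 1)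
    have := hle i
    have := hle j
    have := hle (i + 1)
    have := hle (j + 1)
    split_ifs at h h0 <;> omega

/-- Every rook vector has an R-code: remove the letter `n + 1` or, if it does not occur, the first
zero. -/
theorem exists_codeVec_eq {n : ℕ} {f : ℕ → ℕ} (hf : IsRookSeq n f) :
    ∃ c ∈ RCodes n, codeVec n c = f := by
  induction n generalizing f with
  | zero => exact ⟨fun _ => 0, trivial, funext fun j => (hf.eq j (Nat.zero_le j)).symm⟩
  | succ n ih =>
    by_cases hex : ∃ p ≤ n, f p = n + 1
    · obtain ⟨p, hp, hfp⟩ := hex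
      obtain ⟨c, hc, hcf⟩ := ih (hf.removeSeq hp fun j hj hjp => by
        have h1 := hf.le j (by omega)
        have h2 := hf.inj j p
        omega)
      refine ⟨snocWord c (p + 1), ?_, ?_⟩
      · rw [mem_RCodes_succ, init_snocWord, snocWord_last]
        have := codeM_nonneg n c
        exact ⟨hc, by omega, by omega⟩
      · rw [codeVec_pos (snocWord_last _ _), init_snocWord, hcf, ← hfp,
          insertSeq_removeSeq hf]
    · have hle : ∀ j ≤ n, f j ≤ n := by
        intro j hj
        have h1 := hf.le j (by omega)
        by_contra h2
        exact hex ⟨j, hj, by omega⟩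
      -- `n + 1` entries with at most `n` nonzero values: one of them vanishes
      have hz : ∃ p, p ≤ n ∧ f p = 0 := by
        by_contra! hz
        obtain ⟨i, hi, j, -, hij, hfij⟩ := Finset.exists_ne_map_eq_of_card_lt_of_maps_to
          (s := Finset.range (n + 1)) (t := Finset.Icc 1 n) (f := f) (by simp) (by
            intro j hj
            have hj : j ≤ n := by simpa [Nat.lt_succ_iff] using hj
            have := hle j hj
            have := hz j hj
            simp; omega)
        exact hij (hf.inj i j hfij (hz i (by simpa [Nat.lt_succ_iff] using hi)))
      -- the first zero is the one to remove, so that the last letter of the code is admissible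
      classical
      obtain ⟨hp, hfp⟩ := Nat.find_spec hz
      have hmin : ∀ j < Nat.find hz, f j ≠ 0 := fun j hj h0 =>
        Nat.find_min hz hj ⟨by omega, h0⟩
      generalize Nat.find hz = p at hp hfp hmin
      obtain ⟨c, hc, hcf⟩ := ih (hf.removeSeq hp fun j hj _ => hle j hj)
      refine ⟨snocWord c (-(p : ℤ)), ?_, ?_⟩
      · rw [mem_RCodes_succ, init_snocWord, snocWord_last]
        refine ⟨hc, ?_, by omega⟩
        obtain ⟨m, hm⟩ : ∃ m : ℕ, codeM n c = m := Int.eq_ofNat_of_zero_le (codeM_nonneg _ _)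
        have hz := (codeVec_eq_zero hc hm).1
        by_contra hlt
        have hmp : m < p := by omega
        rw [hcf, removeSeq, if_pos hmp] at hz
        exact hmin m hmp (hz (by omega))
      · rw [codeVec_neg (snocWord_last _ _), init_snocWord, hcf]
        conv_rhs => rw [← insertSeq_removeSeq hf, hfp]

/-! ### The operators on sequences -/

/-- The operator `P_1` on sequences. -/
def seqKill (f : ℕ → ℕ) (j : ℕ) : ℕ := if j = 0 then 0 else f j

/-- Exchange the entries at the positions `k - 1` and `k`. -/
def seqSwap (k : ℕ) (f : ℕ → ℕ) (j : ℕ) : ℕ :=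
  if j + 1 = k then f k else if j = k then f (k - 1) else f j

/-- Sort the entries at the positions `k - 1` and `k` in decreasing order. -/
def seqSort (k : ℕ) (f : ℕ → ℕ) (j : ℕ) : ℕ :=
  if j + 1 = k then max (f (k - 1)) (f k) else if j = k then min (f (k - 1)) (f k) else f j

/-- The generators of `F_n^0` on sequences. -/
def seqOp0 (k : ℕ) : (ℕ → ℕ) → ℕ → ℕ := if k = 0 then seqKill else seqSort k

/-- The generators of `F_n^1` on sequences. -/
def seqOp1 (k : ℕ) : (ℕ → ℕ) → ℕ → ℕ := if k = 0 then seqKill else seqSwap k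

theorem entries_killFirst {n : ℕ} (hn : 0 < n) (r : RookVec n) :
    entries (killFirst r) = seqKill (entries r) := by
  funext j
  simp only [entries, seqKill, killFirst]
  split_ifs <;> first | rfl | omega

theorem val_prev {n : ℕ} (i : Fin n) : (prev i : ℕ) = (i : ℕ) - 1 := rfl

theorem entries_swapAt {n : ℕ} (i : Fin n) (r : RookVec n) :
    entries (swapAt i r) = seqSwap i (entries r) := by
  funext j
  rcases lt_or_ge j n with hj | hj
  · rw [entries_of_lt _ hj, seqSwap]
    change (r.1 (Equiv.swap (prev i) i ⟨j, hj⟩) : ℕ) = _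
    split_ifs with h1 h2
    · rw [show (⟨j, hj⟩ : Fin n) = prev i from Fin.ext (by rw [val_prev]; simp; omega),
        Equiv.swap_apply_left, entries_of_lt r i.2]
    · rw [show (⟨j, hj⟩ : Fin n) = i from Fin.ext h2, Equiv.swap_apply_right,
        entries_of_lt r (by omega)]
      rfl
    · rw [Equiv.swap_apply_of_ne_of_ne, entries_of_lt r hj]
      · intro h
        have := Fin.mk.inj_iff.1 h
        omega
      · intro h
        exact h2 (Fin.mk.inj_iff.1 h)
  · have := i.2
    rw [entries_of_ge _ hj, seqSwap, if_neg (by omega), if_neg (by omega), entries_of_ge _ hj]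

theorem entries_op1 {n : ℕ} (i : Fin n) (r : RookVec n) :
    entries (op1 i r) = seqOp1 i (entries r) := by
  have := i.2
  unfold op1 seqOp1
  split_ifs with h
  · exact entries_killFirst (by omega) r
  · exact entries_swapAt i r

theorem entries_op0 {n : ℕ} (i : Fin n) (r : RookVec n) :
    entries (op0 i r) = seqOp0 i (entries r) := by
  have hin := i.2
  unfold op0 seqOp0
  split_ifs with h h1
  · exact entries_killFirst (by omega) r
  · rw [entries_swapAt i r]
    have e : entries r (i - 1) < entries r i := by
      rw [entries_of_lt r i.2, entries_of_lt r (by omega)]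
      exact h1
    funext j
    unfold seqSwap seqSort
    split_ifs <;> omega
  · have e : ¬ entries r (i - 1) < entries r i := by
      rw [entries_of_lt r i.2, entries_of_lt r (by omega)]
      exact h1
    funext j
    unfold seqSort
    split_ifs with h2 h3
    · rw [show j = i - 1 by omega]; omega
    · rw [h3]; omega
    · rfl

theorem applyTo_mul {n : ℕ} (r : RookVec n) (x y : RightFun n) :
    applyTo r (x * y) = applyTo (applyTo r x) y := rfl

theorem rightFun_ext {n : ℕ} {x y : RightFun n}
    (h : ∀ r, entries (applyTo r x) = entries (applyTo r y)) : x = y :=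
  MulOpposite.unop_injective (funext fun r => entries_injective n (h r))

/-- The operators `op 0, …, op (n-1)`, with the value `1` at unused indices. -/
def opGen {n : ℕ} (op : Fin n → RookVec n → RookVec n) (i : ℕ) : RightFun n :=
  if h : i < n then rightFun (op ⟨i, h⟩) else 1

theorem opGen_val {n : ℕ} (op : Fin n → RookVec n → RookVec n) (i : Fin n) :
    opGen op i = rightFun (op i) := dif_pos i.2

theorem entries_applyTo_opGen {n : ℕ} {op : Fin n → RookVec n → RookVec n}
    {S : ℕ → (ℕ → ℕ) → ℕ → ℕ} (h : ∀ i r, entries (op i r) = S i (entries r)) {i : ℕ}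
    (hi : i < n) (r : RookVec n) : entries (applyTo r (opGen op i)) = S i (entries r) := by
  rw [opGen, dif_pos hi]
  exact h ⟨i, hi⟩ r

theorem rookRelations_op0 (n : ℕ) : RookRelations n (opGen (n := n) op0) where
  zero_mul_zero h := by
    refine rightFun_ext fun r => ?_
    simp only [applyTo_mul, entries_applyTo_opGen entries_op0, h]
    funext j
    simp only [seqOp0, if_pos, seqKill]
    split_ifs <;> rfl
  braid i h1 h2 := by
    have h3 : i < n := by omega
    refine rightFun_ext fun r => ?_
    simp only [applyTo_mul, entries_applyTo_opGen entries_op0, h2, h3]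
    generalize entries r = f
    funext j
    simp only [seqOp0, if_neg (show i ≠ 0 by omega), if_neg (show i + 1 ≠ 0 by omega)]
    obtain ⟨i, rfl⟩ : ∃ k, i = k + 1 := ⟨i - 1, by omega⟩
    have n1 : i ≠ i + 1 + 1 := by omega
    have n2 : i + 1 + 1 ≠ i := by omega
    rcases (by omega : j = i ∨ j = i + 1 ∨ j = i + 2 ∨ (j ≠ i ∧ j ≠ i + 1 ∧ j ≠ i + 2)) with
      rfl | rfl | rfl | ⟨h4, h5, h6⟩
    · simp [seqSort, n1, n2]; omega
    · simp [seqSort, n1, n2]; omega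
    · simp [seqSort, n1, n2]
    · simp [seqSort, h4, h5, h6]
  comm i j h1 h2 := by
    have h3 : i < n := by omega
    refine rightFun_ext fun r => ?_
    simp only [applyTo_mul, entries_applyTo_opGen entries_op0, h1, h3]
    generalize entries r = f
    funext k
    unfold seqOp0
    rw [if_neg (by omega)]
    split_ifs
    · simp only [seqSort, seqKill]
      grind
    · simp only [seqSort]
      grind
  one_zero h := by
    have h3 : 0 < n := by omega
    refine rightFun_ext fun r => ?_
    simp only [applyTo_mul, entries_applyTo_opGen entries_op0, h, h3]
    generalize entries r = f
    funext j
    rcases j with _ | _ | j <;> simp [seqOp0, seqSort, seqKill]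
  zero_one h := by
    have h3 : 0 < n := by omega
    refine rightFun_ext fun r => ?_
    simp only [applyTo_mul, entries_applyTo_opGen entries_op0, h, h3]
    generalize entries r = f
    funext j
    rcases j with _ | _ | j <;> simp [seqOp0, seqSort, seqKill]

theorem op0_sq {n : ℕ} (t : ℕ) (ht : 1 ≤ t) (htn : t < n) :
    opGen (n := n) op0 t * opGen op0 t = opGen op0 t := by
  refine rightFun_ext fun r => ?_
  simp only [applyTo_mul, entries_applyTo_opGen entries_op0, htn]
  generalize entries r = f
  funext j
  simp only [seqOp0, if_neg (show t ≠ 0 by omega)]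
  obtain ⟨i, rfl⟩ : ∃ k, t = k + 1 := ⟨t - 1, by omega⟩
  rcases (by omega : j = i ∨ j = i + 1 ∨ (j ≠ i ∧ j ≠ i + 1)) with rfl | rfl | ⟨h4, h5⟩
  · simp [seqSort]
  · simp [seqSort]
  · simp [seqSort, h4, h5]

theorem rookRelations_op1 (n : ℕ) : RookRelations n (opGen (n := n) op1) where
  zero_mul_zero h := by
    refine rightFun_ext fun r => ?_
    simp only [applyTo_mul, entries_applyTo_opGen entries_op1, h]
    funext j
    simp only [seqOp1, if_pos, seqKill]
    split_ifs <;> rfl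
  braid i h1 h2 := by
    have h3 : i < n := by omega
    refine rightFun_ext fun r => ?_
    simp only [applyTo_mul, entries_applyTo_opGen entries_op1, h2, h3]
    generalize entries r = f
    funext j
    simp only [seqOp1, if_neg (show i ≠ 0 by omega), if_neg (show i + 1 ≠ 0 by omega)]
    obtain ⟨i, rfl⟩ : ∃ k, i = k + 1 := ⟨i - 1, by omega⟩
    have n1 : i ≠ i + 1 + 1 := by omega
    have n2 : i + 1 + 1 ≠ i := by omega
    rcases (by omega : j = i ∨ j = i + 1 ∨ j = i + 2 ∨ (j ≠ i ∧ j ≠ i + 1 ∧ j ≠ i + 2)) with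
      rfl | rfl | rfl | ⟨h4, h5, h6⟩
    · simp [seqSwap, n1, n2]
    · simp [seqSwap, n1, n2]
    · simp [seqSwap, n1]
    · simp [seqSwap, h4, h5, h6]
  comm i j h1 h2 := by
    have h3 : i < n := by omega
    refine rightFun_ext fun r => ?_
    simp only [applyTo_mul, entries_applyTo_opGen entries_op1, h1, h3]
    generalize entries r = f
    funext k
    unfold seqOp1
    rw [if_neg (by omega)]
    split_ifs
    · simp only [seqSwap, seqKill]
      grind
    · simp only [seqSwap]
      grind
  one_zero h := by
    have h3 : 0 < n := by omega
    refine rightFun_ext fun r => ?_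
    simp only [applyTo_mul, entries_applyTo_opGen entries_op1, h, h3]
    generalize entries r = f
    funext j
    rcases j with _ | _ | j <;> simp [seqOp1, seqSwap, seqKill]
  zero_one h := by
    have h3 : 0 < n := by omega
    refine rightFun_ext fun r => ?_
    simp only [applyTo_mul, entries_applyTo_opGen entries_op1, h, h3]
    generalize entries r = f
    funext j
    rcases j with _ | _ | j <;> simp [seqOp1, seqSwap, seqKill]

theorem op1_sq {n : ℕ} (t : ℕ) (ht : 1 ≤ t) (htn : t < n) :
    opGen (n := n) op1 t * opGen op1 t = 1 := by
  refine rightFun_ext fun r => ?_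
  change _ = entries r
  simp only [applyTo_mul, entries_applyTo_opGen entries_op1, htn]
  generalize entries r = f
  funext j
  simp only [seqOp1, if_neg (show t ≠ 0 by omega)]
  obtain ⟨i, rfl⟩ : ∃ k, t = k + 1 := ⟨t - 1, by omega⟩
  rcases (by omega : j = i ∨ j = i + 1 ∨ (j ≠ i ∧ j ≠ i + 1)) with rfl | rfl | ⟨h4, h5⟩
  · simp [seqSwap]
  · simp [seqSwap]
  · simp [seqSwap, h4, h5]

/-! ### Canonical words acting on rook vectors -/

/-- The rook vector `(1, 2, …, n)`. -/
def idVec (n : ℕ) : RookVec n :=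
  ⟨fun j => j.succ, fun _ _ h _ => Fin.succ_injective n h⟩

theorem entries_idVec (n : ℕ) : entries (idVec n) = fun j => j + 1 := by
  funext j
  unfold entries
  split_ifs <;> rfl

/-- The two properties shared by the operators generating `F_n^0` and `F_n^1`: the operator `0`
kills the first entry, and the operator `k ≥ 1` exchanges two neighbouring entries that are in
increasing order. All exchanges made by a canonical word acting on `(1, …, n)` are of this kind. -/
structure ActsLikeRook (n : ℕ) (x : ℕ → RightFun n) : Prop where
  kill : 0 < n → ∀ r, entries (applyTo r (x 0)) = seqKill (entries r)
  swap : ∀ k, 1 ≤ k → k < n → ∀ r, entries r (k - 1) < entries r k →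
    entries (applyTo r (x k)) = seqSwap k (entries r)

theorem actsLikeRook_op1 (n : ℕ) : ActsLikeRook n (opGen (n := n) op1) where
  kill hn r := by rw [entries_applyTo_opGen entries_op1 hn, seqOp1, if_pos rfl]
  swap k h1 h2 r _ := by rw [entries_applyTo_opGen entries_op1 h2, seqOp1, if_neg (by omega)]

theorem actsLikeRook_op0 (n : ℕ) : ActsLikeRook n (opGen (n := n) op0) where
  kill hn r := by rw [entries_applyTo_opGen entries_op0 hn, seqOp0, if_pos rfl]
  swap k h1 h2 r h := by
    rw [entries_applyTo_opGen entries_op0 h2, seqOp0, if_neg (by omega)]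
    funext j
    unfold seqSwap seqSort
    split_ifs <;> omega

namespace ActsLikeRook

variable {n : ℕ} {x : ℕ → RightFun n} (h : ActsLikeRook n x)
include h

/-- A descending run moves a large entry to the left. -/
theorem entries_down {a l : ℕ} (ha : 1 ≤ a) (hl : a + l ≤ n) (r : RookVec n)
    (hr : ∀ j < a + l - 1, entries r j < entries r (a + l - 1)) :
    entries (applyTo r (down x a l)) =
      insertSeq (a - 1) (a + l - 1) (entries r (a + l - 1)) (entries r) := by
  induction l generalizing a with
  | zero =>
    rw [down_zero]
    change entries r = _
    funext j
    unfold insertSeq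
    split_ifs with h1 h2
    · rfl
    · rw [h2]; rfl
    · omega
    · rfl
  | succ l ih =>
    have e : a + 1 + l - 1 = a + l := by omega
    have e' : a + (l + 1) - 1 = a + l := by omega
    have ih := ih (a := a + 1) (by omega) (by omega) (by rw [e]; rwa [e'] at hr)
    rw [e, Nat.add_sub_cancel] at ih
    rw [e'] at hr ⊢
    rw [down_succ', applyTo_mul, h.swap a ha (by omega), ih]
    · funext j
      unfold seqSwap insertSeq
      split_ifs <;> first | omega | rfl | (congr 1; omega)
    · rw [ih, insertSeq_self, insertSeq, if_pos (by omega)]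
      exact hr _ (by omega)

/-- The column of a zero kills the last entry and inserts a zero at position `i`, provided that no
earlier zero stands to the left of this position. -/
theorem entries_col {k i : ℕ} (hk : k < n) (hi : i ≤ k) (r : RookVec n)
    (hr : ∀ j < k, entries r j < entries r k) (h0 : ∀ j < i, entries r j ≠ 0) :
    entries (applyTo r (down x 0 (k + 1) * up x 1 i)) = insertSeq i k 0 (entries r) := by
  induction i with
  | zero =>
    have := h.entries_down (a := 1) (l := k) le_rfl (by omega) r
      (by rwa [Nat.add_sub_cancel_left])
    rw [Nat.add_sub_cancel_left] at this
    rw [up_zero, mul_one, down_succ', applyTo_mul, h.kill (by omega), this]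
    funext j
    unfold seqKill insertSeq
    split_ifs <;> omega
  | succ i ih =>
    have ih := ih (by omega) fun j hj => h0 j (by omega)
    rw [up_succ, ← mul_assoc, applyTo_mul, h.swap (1 + i) (by omega) (by omega), ih]
    · funext j
      unfold seqSwap insertSeq
      split_ifs <;> first | omega | rfl | (congr 1; omega)
    · rw [ih, Nat.add_sub_cancel_left, insertSeq_self, insertSeq, if_neg (by omega),
        if_neg (by omega), if_pos (by omega), Nat.add_sub_cancel_left]
      exact Nat.pos_of_ne_zero (h0 i (by omega))

/-- The canonical word of `c` sends `(1, …, n)` to the rook vector with R-code `c`. -/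
theorem entries_codeProd {k : ℕ} (hk : k ≤ n) {c : Fin k → ℤ} (hc : c ∈ RCodes k) :
    entries (applyTo (idVec n) (codeProd x k c)) = codeVec k c := by
  induction k with
  | zero =>
    have : codeProd x 0 c = 1 := by simp [codeProd, codeWord, wordProd]
    rw [this]
    exact entries_idVec n
  | succ k ih =>
    have h1 := (mem_RCodes_succ.1 hc).1
    have hs := isRookSeq_codeVec h1
    have ih := ih (by omega) h1
    have hk1 : codeVec k (Fin.init c) k = k + 1 := hs.eq k le_rfl
    have hlt : ∀ j < k, codeVec k (Fin.init c) j < codeVec k (Fin.init c) k := by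
      intro j hj
      have := hs.le j hj
      omega
    rw [codeProd_succ, applyTo_mul]
    rcases RCode_cases hc with ⟨p, hp, hd⟩ | ⟨p, hp, hd⟩
    · have e : p + 1 + (k + 1 - (p + 1)) - 1 = k := by omega
      rw [codeVec_pos hd, hd, ← Nat.cast_succ, wordProd_colWord_pos (by omega),
        h.entries_down (by omega) (by omega), e, ih, hk1]
      · rfl
      · rw [e, ih]; exact hlt
    · have hm := codeM_le h1
      obtain ⟨m, hm'⟩ : ∃ m : ℕ, codeM k (Fin.init c) = m :=
        Int.eq_ofNat_of_zero_le (codeM_nonneg _ _)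
      rw [codeVec_neg hd, hd, wordProd_colWord_neg, h.entries_col (by omega) (by omega), ih]
      · rw [ih]; exact hlt
      · rw [ih]
        exact fun j hj => (codeVec_eq_zero h1 hm').2 j (by omega)

theorem bijective_code :
    Function.Bijective fun c : RCodes n => applyTo (idVec n) (codeProd x n c) := by
  refine ⟨fun c c' hcc => ?_, fun r => ?_⟩
  · have := congrArg entries hcc
    simp only [h.entries_codeProd le_rfl c.2, h.entries_codeProd le_rfl c'.2] at this
    exact Subtype.ext (codeVec_injOn c.2 c'.2 this)
  · obtain ⟨c, hc, hcr⟩ := exists_codeVec_eq (isRookSeq_entries r)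
    exact ⟨⟨c, hc⟩, entries_injective n ((h.entries_codeProd le_rfl hc).trans hcr)⟩

/-- A monoid in which every element is the value of a canonical word, and which acts on rook
vectors, acts faithfully and is in bijection with the R-codes. -/
theorem injective_of_surjective_code {G : Type*} [Monoid G] {g : ℕ → G}
    (hg : Function.Surjective fun c : RCodes n => codeProd g n c) (φ : G →* RightFun n)
    (hφ : ∀ i, φ (g i) = x i) :
    Function.Injective φ ∧ Function.Bijective fun c : RCodes n => codeProd g n c := by
  have e : ∀ c : RCodes n, φ (codeProd g n c) = codeProd x n c := by
    intro c
    simp only [codeProd, wordProd, map_list_prod, List.map_map]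
    congr 2
    exact funext hφ
  have key : ∀ c c' : RCodes n, φ (codeProd g n c) = φ (codeProd g n c') → c = c' := by
    intro c c' hcc
    rw [e, e] at hcc
    exact h.bijective_code.1 (congrArg (applyTo (idVec n)) hcc)
  refine ⟨fun a b hab => ?_, fun c c' hcc => key c c' (congrArg φ hcc), hg⟩
  obtain ⟨c, rfl⟩ := hg a
  obtain ⟨c', rfl⟩ := hg b
  rw [key c c' hab]

end ActsLikeRook

/-- An injective homomorphism identifies a monoid generated by a family with the submonoid generated
by the image of the family. -/
theorem exists_mulEquiv_closure {ι M M' : Type*} [Monoid M] [Monoid M'] (φ : M →* M')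
    (hφ : Function.Injective φ) {γ : ι → M} (hγ : Submonoid.closure (Set.range γ) = ⊤)
    {γ' : ι → M'} (h : ∀ i, φ (γ i) = γ' i) {S : Submonoid M'}
    (hS : S = Submonoid.closure (Set.range γ')) : ∃ e : M ≃* S, ∀ a, (e a : M') = φ a := by
  have hr : MonoidHom.mrange φ = S := by
    rw [hS, MonoidHom.mrange_eq_map, ← hγ, MonoidHom.map_mclosure, ← Set.range_comp]
    congr 2
    exact funext h
  refine ⟨(MulEquiv.ofBijective φ.mrangeRestrict ⟨fun a b hab => hφ ?_,
    φ.mrangeRestrict_surjective⟩).trans (MulEquiv.submonoidCongr hr), fun a => rfl⟩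
  exact congrArg Subtype.val hab

/-! ### Homomorphisms from the presented monoids to operators on rook vectors -/

theorem closure_range_pi0 (n : ℕ) :
    Submonoid.closure (Set.range fun i : Fin n => pi0 n i) = ⊤ := by
  set S := Submonoid.closure (Set.range fun i : Fin n => pi0 n i)
  have hpi : ∀ i < n, pi0 n i ∈ S := fun i hi => Submonoid.subset_closure ⟨⟨i, hi⟩, rfl⟩
  have hk : ∀ i ≤ n, killer (pi0 n) i ∈ S := by
    intro i hi
    induction i with
    | zero => exact S.one_mem
    | succ i ih =>
      exact S.mul_mem (S.mul_mem (ih (by omega)) (hpi i hi)) (ih (by omega))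
  rw [← top_le_iff, ← PresentedMonoid.closure_range_of, Submonoid.closure_le]
  rintro _ ⟨i | i, rfl⟩
  · rw [← pi0_eq]; exact hpi _ (by omega)
  · rw [← killer_pi0]; exact hk _ (by omega)

theorem closure_range_s1 (n : ℕ) :
    Submonoid.closure (Set.range fun i : Fin n => s1 n i) = ⊤ := by
  rw [← PresentedMonoid.closure_range_of]
  congr 2
  exact funext fun i => dif_pos i.2

theorem surjective_piCode (n : ℕ) : Function.Surjective fun c : RCodes n => piCode n c := by
  intro a
  obtain ⟨c, hc, h⟩ := (rookRelations_pi0 n).exists_code (q := 0)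
    (Or.inl ⟨rfl, fun t _ => pi0_sq t⟩) (x := a) (by rw [closure_range_pi0]; trivial)
  exact ⟨⟨c, hc⟩, h⟩

theorem surjective_sCode (n : ℕ) : Function.Surjective fun c : RCodes n => sCode n c := by
  intro a
  obtain ⟨c, hc, h⟩ := (rookRelations_s1 n).exists_code (q := 1)
    (Or.inr ⟨rfl, fun t => s1_sq t⟩) (x := a) (by rw [closure_range_s1]; trivial)
  exact ⟨⟨c, hc⟩, h⟩

theorem exists_hom_G0 (n : ℕ) : ∃ φ : G0 n →* RightFun n, ∀ i, φ (pi0 n i) = opGen op0 i := by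
  have hk := (rookRelations_op0 n).lift_eq_of_HRel op0_sq
  refine ⟨PresentedMonoid.lift (halversonGen (opGen op0)) hk, fun i => ?_⟩
  rcases lt_or_ge i n with hi | hi
  · rcases Nat.eq_zero_or_pos i with rfl | h0
    · rw [pi0_zero hi]
      refine (PresentedMonoid.lift_of _ _).trans ?_
      simp [halversonGen, killer]
    · rw [pi0_eq ⟨h0, hi⟩]
      exact PresentedMonoid.lift_of _ _
  · rw [pi0, dif_neg (by omega), opGen, dif_neg (by omega), map_one]

theorem exists_hom_G1 (n : ℕ) : ∃ φ : G1 n →* RightFun n, ∀ i, φ (s1 n i) = opGen op1 i := by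
  have hk := (rookRelations_op1 n).lift_eq_of_RsRel op1_sq
  refine ⟨PresentedMonoid.lift (fun i : Fin n => opGen op1 i) hk, fun i => ?_⟩
  rcases lt_or_ge i n with hi | hi
  · rw [s1, dif_pos hi]
    exact PresentedMonoid.lift_of _ _
  · rw [s1, dif_neg (by omega), opGen, dif_neg (by omega), map_one]

/-! ### Rook matrices -/

theorem bijective_rookMatrix (n : ℕ) : Function.Bijective (rookMatrix (n := n)) := by
  have happ : ∀ (r : RookVec n) i j, (rookMatrix r : Matrix (Fin n) (Fin n) ℤ) i j =
    if (r.1 j : ℕ) = (i : ℕ) + 1 then 1 else 0 := fun r i j => rfl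
  refine ⟨fun r r' h => ?_, fun A => ?_⟩
  · have key : ∀ i j, (r.1 j : ℕ) = (i : Fin n) + 1 ↔ (r'.1 j : ℕ) = i + 1 := by
      intro i j
      have e := congrFun (congrFun (congrArg Subtype.val h) i) j
      rw [happ, happ] at e
      split_ifs at e <;> simp_all
    refine Subtype.ext (funext fun j => Fin.ext ?_)
    have b1 := (r.1 j).2
    have b2 := (r'.1 j).2
    rcases Nat.eq_zero_or_pos (r.1 j : ℕ) with h0 | h0
    · rcases Nat.eq_zero_or_pos (r'.1 j : ℕ) with h0' | h0'
      · omega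
      · have := (key ⟨(r'.1 j : ℕ) - 1, by omega⟩ j).2 (by simp; omega)
        simp only at this
        omega
    · have := (key ⟨(r.1 j : ℕ) - 1, by omega⟩ j).1 (by simp; omega)
      simp only at this
      omega
  · obtain ⟨A, h1, h2, h3⟩ := A
    have hex : ∀ j, ∃ k : Fin (n + 1), (∀ i, A i j ≠ 0 ↔ (k : ℕ) = (i : ℕ) + 1) := by
      intro j
      by_cases hA : ∃ i, A i j ≠ 0
      · obtain ⟨i, hi⟩ := hA
        refine ⟨i.succ, fun i' => ⟨fun hi' => ?_, fun he => ?_⟩⟩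
        · rw [h3 i i' j hi hi']; rfl
        · rw [Fin.val_succ] at he
          rwa [show i' = i from Fin.ext (by omega)]
      · push Not at hA
        exact ⟨0, fun i => by simp [hA i]⟩
    choose f hf using hex
    refine ⟨⟨f, fun j j' hjj h0 => ?_⟩, Subtype.ext (Matrix.ext fun i j => ?_)⟩
    · have hpos : (f j : ℕ) ≠ 0 := fun h => h0 (Fin.val_eq_zero_iff.1 h)
      have hlt := (f j).2
      obtain ⟨i, hi⟩ : ∃ i : Fin n, (f j : ℕ) = i + 1 := ⟨⟨(f j : ℕ) - 1, by omega⟩, by simp; omega⟩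
      exact h2 i j j' ((hf j i).2 hi) ((hf j' i).2 (hjj ▸ hi))
    · refine (happ _ i j).trans ?_
      change (if (f j : ℕ) = i + 1 then (1 : ℤ) else 0) = A i j
      have := hf j i
      split_ifs with hc
      · exact ((h1 i j).resolve_left (this.2 hc)).symm
      · by_contra hne
        exact hc (this.1 (Ne.symm hne))

theorem rookMatrix_idVec (n : ℕ) : rookMatrix (idVec n) = 1 := by
  refine Subtype.ext (Matrix.ext fun i j => ?_)
  change (if ((j.succ : Fin (n + 1)) : ℕ) = (i : ℕ) + 1 then (1 : ℤ) else 0) =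
    (1 : Matrix (Fin n) (Fin n) ℤ) i j
  rw [Matrix.one_apply, Fin.val_succ]
  congr 1
  simp [Fin.ext_iff, eq_comm]

theorem coe_rookMatrix_op1 {n : ℕ} (i : Fin n) (r : RookVec n) :
    (rookMatrix (op1 i r) : Matrix (Fin n) (Fin n) ℤ) = rookMatrix r * rookGen i := by
  ext a b
  unfold op1 rookGen
  split_ifs with h
  · rw [Matrix.mul_diagonal]
    change (if ((if (b : ℕ) = 0 then 0 else r.1 b : Fin (n + 1)) : ℕ) = a + 1 then (1 : ℤ) else 0)
      = (if (r.1 b : ℕ) = a + 1 then 1 else 0) * _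
    split_ifs <;> simp_all
  · rw [Equiv.Perm.permMatrix, PEquiv.mul_toMatrix_toPEquiv, Equiv.symm_swap]
    rfl

/-- The generators of the rook monoid as elements of it. -/
def rookGenerator {n : ℕ} (i : Fin n) : RookMonoid n := rookMatrix (op1 i (idVec n))

theorem coe_rookGenerator {n : ℕ} (i : Fin n) :
    (rookGenerator i : Matrix (Fin n) (Fin n) ℤ) = rookGen i := by
  rw [rookGenerator, coe_rookMatrix_op1, rookMatrix_idVec, OneMemClass.coe_one, one_mul]

theorem rookMatrix_op1 {n : ℕ} (i : Fin n) (r : RookVec n) :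
    rookMatrix (op1 i r) = rookMatrix r * rookGenerator i := by
  refine Subtype.ext ?_
  rw [coe_rookMatrix_op1, ← coe_rookGenerator]
  rfl

/-- The generators reach every rook matrix, because canonical words reach every rook vector. -/
theorem closure_range_rookGenerator (n : ℕ) :
    Submonoid.closure (Set.range (rookGenerator (n := n))) = ⊤ := by
  have key : ∀ x ∈ F1 n, ∃ B ∈ Submonoid.closure (Set.range (rookGenerator (n := n))),
      ∀ r, rookMatrix (applyTo r x) = rookMatrix r * B := by
    intro x hx
    induction hx using Submonoid.closure_induction with
    | mem x hx =>
      obtain ⟨i, rfl⟩ := hx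
      exact ⟨_, Submonoid.subset_closure ⟨i, rfl⟩, rookMatrix_op1 i⟩
    | one => exact ⟨1, Submonoid.one_mem _, fun r => (mul_one _).symm⟩
    | mul x y _ _ hx hy =>
      obtain ⟨A, hA, hxA⟩ := hx
      obtain ⟨B, hB, hyB⟩ := hy
      exact ⟨A * B, Submonoid.mul_mem _ hA hB, fun r => by
        rw [applyTo_mul, hyB, hxA, mul_assoc]⟩
  rw [Submonoid.eq_top_iff']
  intro A
  obtain ⟨r, rfl⟩ := (bijective_rookMatrix n).2 A
  obtain ⟨c, rfl⟩ := (actsLikeRook_op1 n).bijective_code.2 r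
  have hmem : codeProd (opGen (n := n) op1) n c ∈ F1 n := by
    refine Submonoid.list_prod_mem _ fun y hy => ?_
    obtain ⟨j, hj, rfl⟩ := List.mem_map.1 hy
    have hjn := lt_of_mem_codeWord c.2 hj
    rw [opGen, dif_pos hjn]
    exact Submonoid.subset_closure ⟨⟨j, hjn⟩, rfl⟩
  obtain ⟨B, hB, h⟩ := key _ hmem
  change rookMatrix (applyTo (idVec n) (codeProd (opGen (n := n) op1) n c)) ∈ _
  rw [h, rookMatrix_idVec, one_mul]
  exact hB

/-- The rook monoid acts faithfully on rook vectors by right multiplication. -/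
theorem exists_hom_rookMonoid (n : ℕ) : ∃ φ : RookMonoid n →* RightFun n,
    Function.Injective φ ∧
      ∀ A r, rookMatrix (applyTo r (φ A)) = rookMatrix r * A := by
  let E : RookVec n ≃ RookMonoid n := Equiv.ofBijective _ (bijective_rookMatrix n)
  have hE : ∀ A, rookMatrix (E.symm A) = A := E.apply_symm_apply
  let f : RookMonoid n → RightFun n := fun A => rightFun fun r => E.symm (rookMatrix r * A)
  have hf : ∀ A r, rookMatrix (applyTo r (f A)) = rookMatrix r * A := fun A r => hE _
  have hext : ∀ x y : RightFun n,
      (∀ r, rookMatrix (applyTo r x) = rookMatrix (applyTo r y)) → x = y := fun x y h =>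
    rightFun_ext fun r => congrArg entries ((bijective_rookMatrix n).1 (h r))
  refine ⟨{ toFun := f, map_one' := ?_, map_mul' := fun A B => ?_ }, fun A B hAB => ?_, hf⟩
  · exact hext _ _ fun r => (hf 1 r).trans (mul_one _)
  · refine hext _ _ fun r => ?_
    rw [hf, applyTo_mul, hf, hf, mul_assoc]
  · have hA := hf A (idVec n)
    have hB := hf B (idVec n)
    rw [rookMatrix_idVec, one_mul] at hA hB
    rw [← hA, ← hB]
    exact congrArg (fun x => rookMatrix (applyTo (idVec n) x)) hAB

instance (n : ℕ) : Finite (RookVec n) := by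
  unfold RookVec; infer_instance

end ZeroRook

theorem mainTheorem1 (n : ℕ) :
    -- `G_n^0` is presented by the generators `π_0, …, π_{n-1}` and the relations RB1 – RB4
    (∃ e : G0 n ≃* PresentedMonoid (RBRel n),
      ∀ i : Fin n, e (pi0 n i) = PresentedMonoid.of (RBRel n) i) ∧
    -- the action of generators on R-codes is multiplication of canonical words, at `q = 0` …
    (∀ c ∈ RCodes n, ∀ t < n,
      codeAct 0 n c t ∈ RCodes n ∧
      piCode n (codeAct 0 n c t) = piCode n c * pi0 n t ∧
      (codeWord n (codeAct 0 n c t)).length ≤ (codeWord n c).length + 1) ∧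
    -- … and at `q = 1`
    (∀ c ∈ RCodes n, ∀ t < n,
      codeAct 1 n c t ∈ RCodes n ∧
      sCode n (codeAct 1 n c t) = sCode n c * s1 n t ∧
      (codeWord n (codeAct 1 n c t)).length ≤ (codeWord n c).length + 1) ∧
    -- every element is a canonical one
    Function.Surjective (fun c : RCodes n => piCode n c) ∧
    Function.Surjective (fun c : RCodes n => sCode n c) ∧
    -- cardinalities
    Finite (RookMonoid n) ∧
    Nat.card (RCodes n) = Nat.card (RookMonoid n) ∧
    Nat.card (F0 n) = Nat.card (RookMonoid n) ∧
    Nat.card (G0 n) = Nat.card (RookMonoid n) ∧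
    Nat.card (F1 n) = Nat.card (RookMonoid n) ∧
    Nat.card (G1 n) = Nat.card (RookMonoid n) ∧
    -- `G_n^0 ≃ F_n^0` and `G_n^1 ≃ F_n^1`, generators corresponding to generators
    (∃ Φ : G0 n ≃* F0 n, ∀ i : Fin n, (Φ (pi0 n i) : RightFun n) = rightFun (op0 i)) ∧
    (∃ Φ : G1 n ≃* F1 n, ∀ i : Fin n, (Φ (s1 n i) : RightFun n) = rightFun (op1 i)) ∧
    -- `G_n^1 ≃ R_n`, the generators corresponding to the matrices `P_1, s_1, …, s_{n-1}`
    (∃ Θ : G1 n ≃* RookMonoid n,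
      ∀ i : Fin n, (Θ (s1 n i) : Matrix (Fin n) (Fin n) ℤ) = rookGen i) ∧
    -- rook vectors encode rook matrices, and `R_n ≃ F_n^1` by right multiplication
    Function.Bijective (rookMatrix (n := n)) ∧
    (∃ Ψ : RookMonoid n ≃* F1 n,
      ∀ (A : RookMonoid n) (r : RookVec n),
        rookMatrix (applyTo r (Ψ A : RightFun n)) = rookMatrix r * A) := by

  obtain ⟨φ0, hφ0⟩ := exists_hom_G0 n
  obtain ⟨φ1, hφ1⟩ := exists_hom_G1 n
  obtain ⟨ρ, hρ, hρmul⟩ := exists_hom_rookMonoid n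
  obtain ⟨inj0, bij0⟩ := (actsLikeRook_op0 n).injective_of_surjective_code
    (surjective_piCode n) φ0 hφ0
  obtain ⟨inj1, bij1⟩ := (actsLikeRook_op1 n).injective_of_surjective_code
    (surjective_sCode n) φ1 hφ1
  have hρgen : ∀ i, ρ (rookGenerator i) = rightFun (op1 i) := fun i =>
    rightFun_ext fun r => congrArg entries ((bijective_rookMatrix n).1
      ((hρmul _ r).trans (rookMatrix_op1 i r).symm))
  obtain ⟨Φ0, hΦ0⟩ := exists_mulEquiv_closure φ0 inj0 (closure_range_pi0 n)
    (fun i => (hφ0 i).trans (opGen_val op0 i)) (S := F0 n) rfl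
  obtain ⟨Φ1, hΦ1⟩ := exists_mulEquiv_closure φ1 inj1 (closure_range_s1 n)
    (fun i => (hφ1 i).trans (opGen_val op1 i)) (S := F1 n) rfl
  obtain ⟨Ψ, hΨ⟩ := exists_mulEquiv_closure ρ hρ (closure_range_rookGenerator n) hρgen
    (S := F1 n) rfl
  have card0 : Nat.card (RCodes n) = Nat.card (G0 n) := Nat.card_eq_of_bijective _ bij0
  have card1 : Nat.card (RCodes n) = Nat.card (G1 n) := Nat.card_eq_of_bijective _ bij1
  have cardR : Nat.card (RCodes n) = Nat.card (RookMonoid n) :=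
    (Nat.card_eq_of_bijective _ (actsLikeRook_op1 n).bijective_code).trans
      (Nat.card_eq_of_bijective _ (bijective_rookMatrix n))
  have cardF0 : Nat.card (G0 n) = Nat.card (F0 n) := Nat.card_congr Φ0.toEquiv
  have cardF1 : Nat.card (G1 n) = Nat.card (F1 n) := Nat.card_congr Φ1.toEquiv
  refine ⟨exists_equiv_RB n, fun c hc t ht => ?_, fun c hc t ht => ?_, surjective_piCode n,
    surjective_sCode n, Finite.of_surjective _ (bijective_rookMatrix n).2, cardR, ?_, ?_, ?_, ?_,
    ⟨Φ0, fun i => ?_⟩, ⟨Φ1, fun i => ?_⟩, ⟨Φ1.trans Ψ.symm, fun i => ?_⟩,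
    bijective_rookMatrix n, Ψ, fun A r => ?_⟩
  · exact (rookRelations_pi0 n).codeAct_spec (Or.inl ⟨rfl, fun t _ => pi0_sq t⟩) le_rfl hc ht
  · exact (rookRelations_s1 n).codeAct_spec (Or.inr ⟨rfl, fun t => s1_sq t⟩) le_rfl hc ht
  · rw [← cardF0, ← card0, cardR]
  · rw [← card0, cardR]
  · rw [← cardF1, ← card1, cardR]
  · rw [← card1, cardR]
  · rw [hΦ0, hφ0, opGen_val]
  · rw [hΦ1, hφ1, opGen_val]
  · have e : Φ1 (s1 n i) = Ψ (rookGenerator i) :=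
      Subtype.ext (by rw [hΦ1, hφ1, opGen_val, hΨ, hρgen])
    rw [MulEquiv.trans_apply]
    change ((Ψ.symm (Φ1 (s1 n i)) : RookMonoid n) : Matrix (Fin n) (Fin n) ℤ) = rookGen i
    rw [e, MulEquiv.symm_apply_apply, coe_rookGenerator]
  · rw [hΨ]
    exact hρmul A r
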